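/- Let $(X,x)\subset(\mathbb C^n,x)$, $(Y,y)\subset(\mathbb C^m,y)$ and $(Z,z)\subset(\mathbb C^l,z)$ be germs of (reduced) complex analytic spaces, and let $\alpha\colon (Z,z)\to (X,x)$ and $\beta\colon (Z,z)\to (Y,y)$ be morphisms of germs for which the induced homomorphisms of local rings $\alpha_z^*\colon\mathcal O_{X,x}\to\mathcal O_{Z,z}$ and $\beta_z^*\colon\mathcal O_{Y,y}\to\mathcal O_{Z,z}$ are surjective. Choose representatives for which $\alpha$ and $\beta$ are topological embeddings, let $V=(X,x)\sqcup_{(Z,z)}(Y,y)$ be the gluing, i.e. the germ of the topological pushout $X\sqcup_Z Y$ at the common image of $x$ and $y$, with structure sheaf $U\mapsto \mathcal O_X(f^{-1}U)\times_{\mathcal O_Z}\mathcal O_Y(g^{-1}U)$, and let $f\colon (X,x)\to V$ and $g\colon (Y,y)\to V$ be the natural morphisms; $\mathcal O_V$ denotes the local ring of $V$. For a local ring $\mathcal O_T$ of such a germ $T$ and a finitely generated $\mathcal O_T$-module $M$ put $P^T_M(t)=\sum_{i\ge 0}\dim_{\mathbb C}\operatorname{Tor}_i^{\mathcal O_T}(M,\mathbb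 C)\,t^i$, where $\mathbb C$ is the residue field of $\mathcal O_T$. A subspace $W$ of $T$ is given by a proper radical ideal $I$ of $\mathcal O_T$, its local ring is $\mathcal O_W=\mathcal O_T/I$, and $P^T_W:=P^T_{\mathcal O_W}$. Modules over $\mathcal O_{X,x}$ and $\mathcal O_{Y,y}$ are regarded as $\mathcal O_V$-modules via $f^*$ and $g^*$; write $P^V_W$, $P^V_X$, $P^V_Y$ for the series of $\mathcal O_W$, $\mathcal O_{X,x}$, $\mathcal O_{Y,y}$ over $\mathcal O_V$, and $P^X_Z$, $P^Y_Z$ for the series of $\mathcal O_{Z,z}$ over $\mathcal O_{X,x}$ and over $\mathcal O_{Y,y}$. The gluing is called *weakly large* if $P^V_K=P^X_K\cdot P^V_X$ for the $\mathcal O_{X,x}$-module $K=\ker\alpha_z^*$. It is called *strongly large* if $f$ and $g$ are large, i.e. if $P^V_W=P^X_W\cdot P^V_X$ for every subspace $W$ of $(X,x)$ and $P^V_W=P^Y_W\cdot P^V_Y$ for every subspace $W$ of $(Y,y)$. **Theorem.** Suppose that one of the following holds: (i) the gluing is weakly large and there is a surjective homomorphism of $\mathbb C$-algebras $\varphi\colon\mathcal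 O_{Y,y}\to\mathcal O_{X,x}$ with $\alpha_z^*\circ\varphi=\beta_z^*$; (ii) the gluing is strongly large. Then for every subspace $(W,w)$ of $(Y,y)$ the following identity holds in $\mathbb Z[[t]]$ (the denominator being a unit there): $$P^{V}_{W}(t)=\frac{P^{Y}_{W}(t)\,P^{X}_{Z}(t)}{P^{X}_{Z}(t)+P^{Y}_{Z}(t)-P^{X}_{Z}(t)\,P^{Y}_{Z}(t)}.$$ -/

import Mathlib

open Filter Topology CategoryTheory

noncomputable section

/-- The `ℂ`-algebra structure on germs of complex valued functions (constants as germs). -/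
instance germAlgebra {T : Type} (l : Filter T) : Algebra ℂ (Germ l ℂ) where
  algebraMap :=
    { toFun := fun c => ((fun _ : T => c : T → ℂ) : Germ l ℂ)
      map_one' := rfl
      map_mul' := fun _ _ => rfl
      map_zero' := rfl
      map_add' := fun _ _ => rfl }
  commutes' := fun _ _ => mul_comm _ _
  smul_def' := fun c g => by
    induction g using Germ.inductionOn with
    | _ f => rfl

/-- Pullback `h ↦ h ∘ φ` of germs of complex valued functions. -/
def germPullback {S T : Type} [TopologicalSpace S] [TopologicalSpace T] (φ : S → T) {p : S} {q : T}
    (hφ : Tendsto φ (𝓝 p) (𝓝 q)) : Germ (𝓝 q) ℂ →ₐ[ℂ] Germ (𝓝 p) ℂ where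
  toFun g := g.compTendsto φ hφ
  map_one' := rfl
  map_mul' a b := by
    induction a using Germ.inductionOn with
    | _ a => induction b using Germ.inductionOn with
      | _ b => rfl
  map_zero' := rfl
  map_add' a b := by
    induction a using Germ.inductionOn with
    | _ a => induction b using Germ.inductionOn with
      | _ b => rfl
  commutes' _ := rfl

/-- A (reduced) `ℂ`-ringed space: a topological space with a sheaf of local rings of continuous
complex valued functions. The sheaf is recorded through its stalks, `stalk p` being an algebra of
germs at `p`; the sections over an open set `U` are the functions whose germ at every `p ∈ U`
belongs to `stalk p`, and `eventually_mem` says that the stalks of this sheaf are the algebras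
`stalk p`. -/
structure FunSpace where
  carrier : Type
  [top : TopologicalSpace carrier]
  stalk : (p : carrier) → Subalgebra ℂ (Germ (𝓝 p) ℂ)
  eventually_mem : ∀ (p : carrier) (h : carrier → ℂ), (h : Germ (𝓝 p) ℂ) ∈ stalk p →
    ∀ᶠ q in 𝓝 p, (h : Germ (𝓝 q) ℂ) ∈ stalk q
  continuousAt_of_mem : ∀ (p : carrier) (h : carrier → ℂ), (h : Germ (𝓝 p) ℂ) ∈ stalk p →
    ContinuousAt h p
  inv_mem : ∀ (p : carrier) (h : carrier → ℂ), (h : Germ (𝓝 p) ℂ) ∈ stalk p → h p ≠ 0 →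
    ((fun q => (h q)⁻¹ : carrier → ℂ) : Germ (𝓝 p) ℂ) ∈ stalk p

namespace FunSpace

instance : CoeSort FunSpace Type := ⟨FunSpace.carrier⟩

instance (S : FunSpace) : TopologicalSpace S := S.top

/-- The local ring `𝒪_{S,p}`, the stalk at `p` as a type. -/
def localRing (S : FunSpace) (p : S) : Type := S.stalk p

instance (S : FunSpace) (p : S) : CommRing (S.localRing p) :=
  inferInstanceAs (CommRing (S.stalk p))

instance (S : FunSpace) (p : S) : Algebra ℂ (S.localRing p) :=
  inferInstanceAs (Algebra ℂ (S.stalk p))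

/-- Every stalk is a local ring; its maximal ideal consists of the germs that vanish at `p`. -/
instance (S : FunSpace) (p : S) : IsLocalRing (S.localRing p) := by
  change IsLocalRing (S.stalk p)
  have key : ∀ a : S.stalk p, Germ.value a.1 ≠ 0 → IsUnit a := by
    rintro ⟨g, hg⟩ h0
    induction g using Germ.inductionOn with
    | _ h =>
      have h0' : h p ≠ 0 := h0
      refine IsUnit.of_mul_eq_one ⟨_, S.inv_mem p h hg h0'⟩ ?_
      apply Subtype.ext
      change (((fun q => h q * (h q)⁻¹ : S → ℂ)) : Germ (𝓝 p) ℂ) = ((fun _ => 1 : S → ℂ) : Germ (𝓝 p) ℂ)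
      refine Germ.coe_eq.mpr ?_
      filter_upwards [(S.continuousAt_of_mem p h hg).eventually_ne h0'] with q hq
      exact mul_inv_cancel₀ hq
  have : Nontrivial (S.stalk p) := inferInstance
  refine IsLocalRing.of_isUnit_or_isUnit_one_sub_self fun a => ?_
  by_cases ha : Germ.value a.1 = 0
  · right
    apply key
    have : Germ.valueRingHom (1 - a.1) = 1 - Germ.valueRingHom a.1 := by
      rw [map_sub, map_one]
    have h2 : Germ.value (1 - a.1) = 1 - Germ.value a.1 := this
    change Germ.value (1 - a.1) ≠ 0
    rw [h2, ha]
    simp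
  · exact Or.inl (key a ha)

/-- Morphisms: continuous maps along which sections pull back to sections. -/
structure Hom (S T : FunSpace) where
  toFun : S → T
  continuous : Continuous toFun
  pullback_mem : ∀ (p : S), ∀ g ∈ T.stalk (toFun p),
    germPullback toFun (continuous.tendsto p) g ∈ S.stalk p

instance (S T : FunSpace) : CoeFun (Hom S T) (fun _ => S → T) := ⟨Hom.toFun⟩

/-- The homomorphism of stalks `𝒪_{T,q} → 𝒪_{S,p}` induced by a morphism `S → T` with `p ↦ q`. -/
def Hom.stalkMap {S T : FunSpace} (φ : Hom S T) (p : S) (q : T) (hpq : φ p = q) :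
    T.localRing q →ₐ[ℂ] S.localRing p :=
  ((germPullback φ.toFun (hpq ▸ φ.continuous.tendsto p)).comp (T.stalk q).val).codRestrict
    (S.stalk p) (by
      subst hpq
      rintro ⟨g, hg⟩
      exact φ.pullback_mem p g hg)

/-- The topological gluing `X ⊔_Z Y`: the quotient of the disjoint union by the equivalence
relation generated by `α z ∼ β z`, with the quotient topology. -/
abbrev GluedSpace {X Y Z : FunSpace} (α : Hom Z X) (β : Hom Z Y) : Type :=
  Quot (fun a b : X ⊕ Y => ∃ z : Z, a = Sum.inl (α z) ∧ b = Sum.inr (β z))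

namespace GluedSpace

variable {X Y Z : FunSpace} (α : Hom Z X) (β : Hom Z Y)

/-- The natural map `f : X → X ⊔_Z Y`. -/
def inl (x : X) : GluedSpace α β := Quot.mk _ (Sum.inl x)

/-- The natural map `g : Y → X ⊔_Z Y`. -/
def inr (y : Y) : GluedSpace α β := Quot.mk _ (Sum.inr y)

theorem inr_eq_inl (z : Z) : inr α β (β z) = inl α β (α z) :=
  (Quot.sound ⟨z, rfl, rfl⟩).symm

theorem continuous_inl : Continuous (inl α β) := continuous_quot_mk.comp _root_.continuous_inl

theorem continuous_inr : Continuous (inr α β) := continuous_quot_mk.comp _root_.continuous_inr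

/-- A function `h` on `X ⊔_Z Y` is regular at `p` if `h ∘ f` and `h ∘ g` are regular at all points
over `p`. As a function on `X ⊔_Z Y` is a pair of functions on `X` and `Y` that agree on `Z`, the
functions regular on an open set `U` form the ring `𝒪_X(f⁻¹U) ×_{𝒪_Z} 𝒪_Y(g⁻¹U)`. -/
def RegularAt (h : GluedSpace α β → ℂ) (p : GluedSpace α β) : Prop :=
  (∀ x : X, inl α β x = p → ((h ∘ inl α β : X → ℂ) : Germ (𝓝 x) ℂ) ∈ X.stalk x) ∧
  (∀ y : Y, inr α β y = p → ((h ∘ inr α β : Y → ℂ) : Germ (𝓝 y) ℂ) ∈ Y.stalk y)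

/-- Germs at `p` of functions that are regular on a neighbourhood of `p`. -/
def stalk (p : GluedSpace α β) : Subalgebra ℂ (Germ (𝓝 p) ℂ) where
  carrier := {g | ∃ h : GluedSpace α β → ℂ, g = h ∧ ∀ᶠ q in 𝓝 p, RegularAt α β h q}
  mul_mem' := by
    rintro _ _ ⟨a, rfl, ha⟩ ⟨b, rfl, hb⟩
    refine ⟨a * b, rfl, ?_⟩
    filter_upwards [ha, hb] with q ha hb
    exact ⟨fun x hx => mul_mem (ha.1 x hx) (hb.1 x hx), fun y hy => mul_mem (ha.2 y hy) (hb.2 y hy)⟩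
  add_mem' := by
    rintro _ _ ⟨a, rfl, ha⟩ ⟨b, rfl, hb⟩
    refine ⟨a + b, rfl, ?_⟩
    filter_upwards [ha, hb] with q ha hb
    exact ⟨fun x hx => add_mem (ha.1 x hx) (hb.1 x hx), fun y hy => add_mem (ha.2 y hy) (hb.2 y hy)⟩
  algebraMap_mem' := fun c => ⟨fun _ => c, rfl, Eventually.of_forall fun _ =>
    ⟨fun x _ => (X.stalk x).algebraMap_mem c, fun y _ => (Y.stalk y).algebraMap_mem c⟩⟩

theorem mem_stalk (p : GluedSpace α β) (h : GluedSpace α β → ℂ) :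
    (h : Germ (𝓝 p) ℂ) ∈ stalk α β p ↔ ∀ᶠ q in 𝓝 p, RegularAt α β h q := by
  refine ⟨?_, fun H => ⟨h, rfl, H⟩⟩
  rintro ⟨h', e, H⟩
  filter_upwards [(Germ.coe_eq.mp e).eventually_nhds, H] with q hq Hq
  refine ⟨fun x hx => ?_, fun y hy => ?_⟩
  · have : ((h ∘ inl α β : X → ℂ) : Germ (𝓝 x) ℂ) = ((h' ∘ inl α β : X → ℂ) : Germ (𝓝 x) ℂ) :=
      by
      have ht := (continuous_inl α β).tendsto x
      rw [hx] at ht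
      exact Germ.coe_eq.mpr (ht.eventually hq)
    rw [this]
    exact Hq.1 x hx
  · have : ((h ∘ inr α β : Y → ℂ) : Germ (𝓝 y) ℂ) = ((h' ∘ inr α β : Y → ℂ) : Germ (𝓝 y) ℂ) :=
      by
      have ht := (continuous_inr α β).tendsto y
      rw [hy] at ht
      exact Germ.coe_eq.mpr (ht.eventually hq)
    rw [this]
    exact Hq.2 y hy

theorem continuousAt_of_regular (p : GluedSpace α β) (h : GluedSpace α β → ℂ)
    (H : ∀ᶠ q in 𝓝 p, RegularAt α β h q) : ContinuousAt h p := by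
  obtain ⟨U, hU, hUo, hpU⟩ := eventually_nhds_iff.mp H
  intro N hN
  obtain ⟨O, hON, hO, hpO⟩ := mem_nhds_iff.mp hN
  have hV : IsOpen (U ∩ h ⁻¹' O) := by
    rw [← isQuotientMap_quot_mk.isOpen_preimage, isOpen_sum_iff]
    constructor
    · rw [isOpen_iff_mem_nhds]
      rintro x ⟨hxU, hxO⟩
      have c := X.continuousAt_of_mem x _ ((hU _ hxU).1 x rfl)
      exact inter_mem ((hUo.preimage (continuous_inl α β)).mem_nhds hxU)
        (c.preimage_mem_nhds (hO.mem_nhds hxO))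
    · rw [isOpen_iff_mem_nhds]
      rintro y ⟨hyU, hyO⟩
      have c := Y.continuousAt_of_mem y _ ((hU _ hyU).2 y rfl)
      exact inter_mem ((hUo.preimage (continuous_inr α β)).mem_nhds hyU)
        (c.preimage_mem_nhds (hO.mem_nhds hyO))
  exact mem_map.mpr (mem_of_superset (hV.mem_nhds ⟨hpU, hpO⟩) fun q hq => hON hq.2)

end GluedSpace

/-- The gluing `X ⊔_Z Y` as a ringed space. -/
def gluing {X Y Z : FunSpace} (α : Hom Z X) (β : Hom Z Y) : FunSpace where
  carrier := GluedSpace α β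
  stalk := GluedSpace.stalk α β
  eventually_mem p h hh := by
    simp only [GluedSpace.mem_stalk] at hh ⊢
    exact eventually_eventually_nhds.mpr hh
  continuousAt_of_mem p h hh :=
    GluedSpace.continuousAt_of_regular α β p h ((GluedSpace.mem_stalk α β p h).mp hh)
  inv_mem p h hh h0 := by
    have H := (GluedSpace.mem_stalk α β p h).mp hh
    refine (GluedSpace.mem_stalk α β p _).mpr ?_
    filter_upwards [H, (GluedSpace.continuousAt_of_regular α β p h H).eventually_ne h0] with q hq h0q
    exact ⟨fun x hx => X.inv_mem x _ (hq.1 x hx) (by simpa [hx] using h0q),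
      fun y hy => Y.inv_mem y _ (hq.2 y hy) (by simpa [hy] using h0q)⟩

/-- The natural morphism `f : X → X ⊔_Z Y`. -/
def gluingInl {X Y Z : FunSpace} (α : Hom Z X) (β : Hom Z Y) : Hom X (gluing α β) where
  toFun := GluedSpace.inl α β
  continuous := GluedSpace.continuous_inl α β
  pullback_mem := by
    rintro x _ ⟨h, rfl, H⟩
    exact H.self_of_nhds.1 x rfl

/-- The natural morphism `g : Y → X ⊔_Z Y`. -/
def gluingInr {X Y Z : FunSpace} (α : Hom Z X) (β : Hom Z Y) : Hom Y (gluing α β) where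
  toFun := GluedSpace.inr α β
  continuous := GluedSpace.continuous_inr α β
  pullback_mem := by
    rintro y _ ⟨h, rfl, H⟩
    exact H.self_of_nhds.2 y rfl

end FunSpace

/-- `X ⊆ ℂⁿ` is an analytic subset of some open `Ω ⊆ ℂⁿ`: it is closed in `Ω` and, near each of its
points, the common zero set of finitely many analytic functions. -/
def IsAnalyticSet {n : ℕ} (X : Set (Fin n → ℂ)) : Prop :=
  ∃ Ω : Set (Fin n → ℂ), IsOpen Ω ∧ X ⊆ Ω ∧ (∃ C, IsClosed C ∧ X = C ∩ Ω) ∧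
    ∀ x ∈ X, ∃ V ⊆ Ω, IsOpen V ∧ x ∈ V ∧ ∃ (s : ℕ) (f : Fin s → (Fin n → ℂ) → ℂ),
      (∀ i, AnalyticOnNhd ℂ (f i) V) ∧ X ∩ V = {p ∈ V | ∀ i, f i p = 0}

/-- A subset `X ⊆ ℂⁿ` with its sheaf of holomorphic functions: the stalk at `p` consists of the
restrictions to `X` of germs of analytic functions on `ℂⁿ`, so it is `𝒪_{ℂⁿ,p}` modulo the ideal of
the germs that vanish on `X`. For analytic `X` this is the local model of an analytic space. -/
def analyticModel {n : ℕ} (X : Set (Fin n → ℂ)) : FunSpace where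
  carrier := X
  stalk p :=
    { carrier := {g | ∃ F : (Fin n → ℂ) → ℂ, AnalyticAt ℂ F p ∧ g = (fun q : X => F q : X → ℂ)}
      mul_mem' := by
        rintro _ _ ⟨F, hF, rfl⟩ ⟨G, hG, rfl⟩
        exact ⟨F * G, hF.mul hG, rfl⟩
      add_mem' := by
        rintro _ _ ⟨F, hF, rfl⟩ ⟨G, hG, rfl⟩
        exact ⟨F + G, hF.add hG, rfl⟩
      algebraMap_mem' := fun c => ⟨fun _ => c, analyticAt_const, rfl⟩ }
  eventually_mem := by
    rintro p h ⟨F, hF, e⟩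
    filter_upwards [(Germ.coe_eq.mp e).eventually_nhds,
      continuousAt_subtype_val.eventually hF.eventually_analyticAt] with q hq hFq
    exact ⟨F, hFq, Germ.coe_eq.mpr hq⟩
  continuousAt_of_mem := by
    rintro p h ⟨F, hF, e⟩
    have c : ContinuousAt (fun q : X => F q) p :=
      ContinuousAt.comp (g := F) hF.continuousAt continuousAt_subtype_val
    exact c.congr (Germ.coe_eq.mp e).symm
  inv_mem := by
    rintro p h ⟨F, hF, e⟩ h0
    have e' := Germ.coe_eq.mp e
    have hFp : F p ≠ 0 := fun h1 => h0 (e'.self_of_nhds.trans h1)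
    refine ⟨fun q => (F q)⁻¹, hF.inv hFp, Germ.coe_eq.mpr ?_⟩
    filter_upwards [e'] with q hq
    rw [hq]

section Poincare

variable {R S : Type} [CommRing R] [Algebra ℂ R] [IsLocalRing R]
  [CommRing S] [Algebra ℂ S] [IsLocalRing S]

/-- The Betti number `dim_ℂ Tor_i^R(M, R/𝔪)` (used only where it is finite). -/
def bettiNumber (M : ModuleCat.{0} R) (i : ℕ) : ℕ :=
  Module.finrank ℂ ((ModuleCat.restrictScalars (algebraMap ℂ R)).obj
    (((Tor (ModuleCat.{0} R) i).obj M).obj (ModuleCat.of R (IsLocalRing.ResidueField R))))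

/-- The Poincaré series `P^R_M(t) = ∑ dim_ℂ Tor_i^R(M, R/𝔪) tⁱ`. -/
def poincareSeries (M : ModuleCat.{0} R) : PowerSeries ℤ :=
  PowerSeries.mk fun i => (bettiNumber M i : ℤ)

/-- The Poincaré series `P^S_M(t)` of an `S`-module `M`. -/
def poincare (S M : Type) [CommRing S] [Algebra ℂ S] [IsLocalRing S] [AddCommGroup M]
    [Module S M] : PowerSeries ℤ :=
  poincareSeries (ModuleCat.of S M)

/-- The Poincaré series `P^R_M(t)` of an `S`-module `M` that is regarded as an `R`-module along
`φ : R → S`. -/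
def poincareAlong (φ : R →ₐ[ℂ] S) (M : Type) [AddCommGroup M] [Module S M] : PowerSeries ℤ :=
  poincareSeries ((ModuleCat.restrictScalars φ.toRingHom).obj (ModuleCat.of S M))

/-- The (reduced) ideals that define subspaces of a germ with local ring `S`. -/
def IsSubspaceIdeal (I : Ideal S) : Prop := I.IsRadical ∧ I ≠ ⊤

/-- A morphism of germs, with (surjective) homomorphism of local rings `φ : R → S`, is large if
`P^R_W = P^S_W · P^R_S` for all subspaces `W`, with local ring `S/I`, of the germ of `S`. -/
def IsLarge (φ : R →ₐ[ℂ] S) : Prop :=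
  ∀ I : Ideal S, IsSubspaceIdeal I →
    poincareAlong φ (S ⧸ I) = poincare S (S ⧸ I) * poincareAlong φ S

end Poincare

namespace FunSpace

variable {X Y Z : FunSpace} (α : Hom Z X) (β : Hom Z Y) (z : Z)

/-- `α_z^* : 𝒪_{X,x} → 𝒪_{Z,z}`, `x = α z`. -/
abbrev Hom.pullbackAt : X.localRing (α z) →ₐ[ℂ] Z.localRing z := α.stalkMap z (α z) rfl

/-- The Poincaré series `P^{(X,x)}_{(Z,z)}(t)` of the subspace `(Z,z)` of `(X,x)`, `x = α z`. -/
def Hom.poincareAt : PowerSeries ℤ := poincareAlong (α.pullbackAt z) (Z.localRing z)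

/-- The base point of the gluing, the common image of `α z` and `β z`. -/
abbrev gluingPoint : gluing α β := gluingInl α β (α z)

/-- `π₁ : 𝒪_{X ⊔_Z Y} → 𝒪_{X,x}`, induced by `f`. -/
abbrev gluingFst : (gluing α β).localRing (gluingPoint α β z) →ₐ[ℂ] X.localRing (α z) :=
  (gluingInl α β).stalkMap (α z) (gluingPoint α β z) rfl

/-- `π₂ : 𝒪_{X ⊔_Z Y} → 𝒪_{Y,y}`, induced by `g`. -/
abbrev gluingSnd : (gluing α β).localRing (gluingPoint α β z) →ₐ[ℂ] Y.localRing (β z) :=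
  (gluingInr α β).stalkMap (β z) (gluingPoint α β z) (GluedSpace.inr_eq_inl α β z)

/-- The gluing of germs is weakly large: `P_K^{X ⊔_Z Y} = P_K^X · P_X^{X ⊔_Z Y}` for the
`𝒪_{X,x}`-module `K = ker α_z^*`. -/
def WeaklyLarge : Prop :=
  poincareAlong (gluingFst α β z) (RingHom.ker (α.pullbackAt z)) =
    poincare (X.localRing (α z)) (RingHom.ker (α.pullbackAt z)) *
      poincareAlong (gluingFst α β z) (X.localRing (α z))

/-- The gluing of germs is strongly large: both `f` and `g` are large. -/
def StronglyLarge : Prop :=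
  IsLarge (gluingFst α β z) ∧ IsLarge (gluingSnd α β z)

end FunSpace

end

/-! Write R for the local ring of the gluing, A, B, C for those of X, Y, Z, and K ⊂ A, J ⊂ B for the
kernels of the maps to C. Since α and β are embeddings, R is the fibre product A ×_C B
(`isFibreProduct_gluing`). Hence ker(R → B) is K and ker(R → A) is J, as R-modules.

The quotient by a proper ideal has series 1 + t·(series of the ideal). This gives P^R_B = 1 + t
P^R_K, P^R_A = 1 + t P^R_J, P^A_C = 1 + t P^A_K and P^B_C = 1 + t P^B_J. Once P^R_K = P^A_K P^R_A
and P^R_J = P^B_J P^R_B are known, the first two equations are linear in P^R_A and P^R_B. Solving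
them for P^R_B and multiplying by P^B_W gives the formula (`poincareAlong_snd_mul`).

The factorizations have two sources. Strong largeness gives them for quotients S/I, and
`poincareSeries_ideal_of_quotient` passes to I: the inequality ≤ always holds, and a dimension count
gives ≥. In case (i), weak largeness is the factorization for K, and y ↦ (φ y, y) is a section of R
→ B. Over such a retract P^R_M = P^B_M P^R_B for every finitely generated B-module M, because a
minimal cover 0 → N → Bⁿ → M → 0 induces the zero map Tor^R(N, ℂ) → Tor^R(Bⁿ, ℂ)
(`exists_lTensor_resD_eq`), so that both sides satisfy the same recursion along syzygies.

Counting dimensions requires finite Tor, hence Noetherian local rings. For germs of analytic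
functions this is Rückert's argument by Weierstrass division. Division is obtained by inverting an
analytic family of bounded operators on a disk algebra. -/

noncomputable section

/-! ### Tor computed from a resolution of the residue field -/

section TorComplex

open MonoidalCategory

variable (R : Type) [CommRing R] [IsLocalRing R]

/-- A projective resolution of the residue field. -/
def residueResolution : ProjectiveResolution (ModuleCat.of R (IsLocalRing.ResidueField R)) :=
  projectiveResolution _

/-- The complex `M ⊗ P` for the projective resolution `P` of the residue field. -/
def torComplex : ModuleCat.{0} R ⥤ ChainComplex (ModuleCat.{0} R) ℕ where
  obj M := (((tensoringLeft (ModuleCat.{0} R)).obj M).mapHomologicalComplex _).obj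
    (residueResolution R).complex
  map f := (NatTrans.mapHomologicalComplex ((tensoringLeft (ModuleCat.{0} R)).map f) _).app
    (residueResolution R).complex
  map_id M := by ext : 2; simp
  map_comp f g := by ext : 2; simp

instance : (torComplex R).Additive where
  map_add {M N f g} := by
    ext i : 1
    exact MonoidalPreadditive.add_whiskerRight f g

variable {R} in
-- The terms of the resolution are projective, hence flat. As the residue field is the variable that
-- is resolved, the long exact sequence in the other variable needs no horseshoe lemma.
theorem torComplex_shortExact (S : ShortComplex (ModuleCat.{0} R)) (hS : S.ShortExact) :
    ((S.map (torComplex R)).ShortExact) := by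
  refine HomologicalComplex.shortExact_of_degreewise_shortExact _ fun i => ?_
  have hp : Module.Projective R ((residueResolution R).complex.X i) :=
    (IsProjective.iff_projective _).mpr ((residueResolution R).projective i)
  have hf : Module.Flat R ((residueResolution R).complex.X i) := inferInstance
  have h1 := hS.moduleCat_injective_f
  have h2 := hS.moduleCat_surjective_g
  have h3 := (ShortComplex.ShortExact.moduleCat_exact_iff_function_exact S).mp hS.exact
  have e1 : Function.Injective (S.f.hom.rTensor ((residueResolution R).complex.X i)) :=
    Module.Flat.rTensor_preserves_injective_linearMap _ h1
  have e2 : Function.Surjective (S.g.hom.rTensor ((residueResolution R).complex.X i)) :=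
    LinearMap.rTensor_surjective _ h2
  have e3 : Function.Exact (S.f.hom.rTensor ((residueResolution R).complex.X i))
      (S.g.hom.rTensor ((residueResolution R).complex.X i)) := rTensor_exact _ h3 h2
  exact {
    exact := (ShortComplex.ShortExact.moduleCat_exact_iff_function_exact _).mpr e3
    mono_f := (ModuleCat.mono_iff_injective _).mpr e1
    epi_g := (ModuleCat.epi_iff_surjective _).mpr e2 }

variable [Algebra ℂ R]

/-- The `ℂ`-vector space `Tor_i(M, R/𝔪)`. -/
def torSpace (i : ℕ) : ModuleCat.{0} R ⥤ ModuleCat.{0} ℂ :=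
  torComplex R ⋙ HomologicalComplex.homologyFunctor _ _ i ⋙
    ModuleCat.restrictScalars (algebraMap ℂ R)

variable {R}

theorem bettiNumber_eq (M : ModuleCat.{0} R) (i : ℕ) :
    bettiNumber M i = Module.finrank ℂ ((torSpace R i).obj M) :=
  (((ModuleCat.restrictScalars (algebraMap ℂ R)).mapIso
    ((residueResolution R).isoLeftDerivedObj
      ((tensoringLeft (ModuleCat.{0} R)).obj M) i)).toLinearEquiv).finrank_eq

theorem bettiNumber_congr {M N : ModuleCat.{0} R} (e : M ≅ N) (i : ℕ) :
    bettiNumber M i = bettiNumber N i := by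
  rw [bettiNumber_eq, bettiNumber_eq]
  exact ((torSpace R i).mapIso e).toLinearEquiv.finrank_eq

/-- The rank of `Tor_i(f, R/𝔪)`. -/
def torRank {M N : ModuleCat.{0} R} (f : M ⟶ N) (i : ℕ) : ℕ :=
  Module.finrank ℂ (LinearMap.range ((torSpace R i).map f).hom)

variable (S : ShortComplex (ModuleCat.{0} R)) (hS : S.ShortExact)

include hS in
theorem torSpace_exact (i : ℕ) :
    Function.Exact ((torSpace R i).map S.f).hom ((torSpace R i).map S.g).hom :=
  (ShortComplex.ShortExact.moduleCat_exact_iff_function_exact _).mp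
    ((torComplex_shortExact S hS).homology_exact₂ i)

include hS in
theorem torSpace_surjective : Function.Surjective ((torSpace R 0).map S.g).hom := by
  have := torComplex_shortExact S hS
  have h1 : Epi ((S.map (torComplex R)).g.f 0) := by
    have := this.epi_g
    infer_instance
  have h2 := HomologicalComplex.epi_homologyMap_of_epi_of_not_rel
    (S.map (torComplex R)).g 0 (by simp)
  have h3 := (ModuleCat.epi_iff_surjective
    (HomologicalComplex.homologyMap (S.map (torComplex R)).g 0)).mp h2
  exact h3

include hS in
theorem exists_torSpace_connecting (i : ℕ) :
    ∃ δ : (torSpace R (i + 1)).obj S.X₃ →ₗ[ℂ] (torSpace R i).obj S.X₁,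
      Function.Exact ((torSpace R (i + 1)).map S.g).hom δ ∧
        Function.Exact δ ((torSpace R i).map S.f).hom := by
  have h := torComplex_shortExact S hS
  refine ⟨((ModuleCat.restrictScalars (algebraMap ℂ R)).map (h.δ (i + 1) i rfl)).hom, ?_, ?_⟩
  · exact (ShortComplex.ShortExact.moduleCat_exact_iff_function_exact _).mp
      (h.homology_exact₃ (i + 1) i rfl)
  · exact (ShortComplex.ShortExact.moduleCat_exact_iff_function_exact _).mp
      (h.homology_exact₁ (i + 1) i rfl)

end TorComplex

/-! ### Vanishing, finiteness and dimension counts for Tor -/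

section ResidueResolution
open TensorProduct

variable (R : Type) [CommRing R] [IsLocalRing R]

/-- The modules of the projective resolution of the residue field. -/
abbrev ResMod (i : ℕ) : Type := (residueResolution R).complex.X i

/-- The differentials of the projective resolution of the residue field. -/
def resD (i : ℕ) : ResMod R (i + 1) →ₗ[R] ResMod R i :=
  ((residueResolution R).complex.d (i + 1) i).hom

/-- The augmentation of the projective resolution of the residue field. -/
def resAug : ResMod R 0 →ₗ[R] IsLocalRing.ResidueField R := ((residueResolution R).π.f 0).hom

instance (i : ℕ) : Module.Projective R (ResMod R i) :=
  (IsProjective.iff_projective _).mpr ((residueResolution R).projective i)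

theorem resD_exact (i : ℕ) : Function.Exact (resD R (i + 1)) (resD R i) :=
  (ShortComplex.ShortExact.moduleCat_exact_iff_function_exact _).mp
    ((residueResolution R).exact_succ i)

theorem resAug_exact : Function.Exact (resD R 0) (resAug R) :=
  (ShortComplex.ShortExact.moduleCat_exact_iff_function_exact _).mp
    (ShortComplex.exact_of_g_is_cokernel (ShortComplex.mk _ _
      (residueResolution R).complex_d_comp_π_f_zero) (residueResolution R).isColimitCokernelCofork)

theorem resAug_surjective : Function.Surjective (resAug R) :=
  (ModuleCat.epi_iff_surjective ((residueResolution R).π.f 0)).mp inferInstance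

variable {R}

variable [Algebra ℂ R]

theorem torSpace_succ_subsingleton (M : ModuleCat.{0} R) [Module.Flat R M] (i : ℕ) :
    Subsingleton ((torSpace R (i + 1)).obj M) := by
  have h : ((torComplex R).obj M).ExactAt (i + 1) := by
    rw [HomologicalComplex.exactAt_iff' _ (i + 2) (i + 1) i (by simp only [ChainComplex.prev]; rfl)
      (by simp)]
    exact (ShortComplex.ShortExact.moduleCat_exact_iff_function_exact _).mpr
      (Module.Flat.lTensor_exact M (resD_exact R i))
  have := h.isZero_homology
  exact (ModuleCat.isZero_iff_subsingleton (M := ((torComplex R).obj M).homology (i + 1))).mp this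

/-- A map of modules induces zero on `Tor_i` if it sends cycles to boundaries. -/
theorem torSpace_map_eq_zero {M N : ModuleCat.{0} R} (f : M ⟶ N) (i : ℕ)
    (h : ∀ z : M ⊗[R] ResMod R i, (∀ j, ∀ hj : j + 1 = i, (resD R j).lTensor M (hj ▸ z) = 0) →
      ∃ w, (resD R i).lTensor N w = f.hom.rTensor _ z) :
    (torSpace R i).map f = 0 := by
  have h0 : HomologicalComplex.homologyMap ((torComplex R).map f) i = 0 := by
    rw [← cancel_epi (((torComplex R).obj M).homologyπ i),
      HomologicalComplex.homologyπ_naturality, Limits.comp_zero]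
    ext x
    set z := ((torComplex R).obj M).iCycles i x with hz
    -- In degree 0 there is no such j, so the cycle condition is empty there.
    have hz0 : ∀ j, ∀ hj : j + 1 = i, (resD R j).lTensor M (hj ▸ z) = 0 := by
      rintro j rfl
      have := ConcreteCategory.congr_hom (((torComplex R).obj M).iCycles_d (j + 1) j) x
      exact this
    obtain ⟨w, hw⟩ := h z hz0
    have : HomologicalComplex.cyclesMap ((torComplex R).map f) i x =
        ((torComplex R).obj N).toCycles (i + 1) i w := by
      have hm : Function.Injective (((torComplex R).obj N).iCycles i) :=
        (ModuleCat.mono_iff_injective (((torComplex R).obj N).iCycles i)).mp inferInstance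
      apply hm
      have e1 := ConcreteCategory.congr_hom
        (HomologicalComplex.cyclesMap_i ((torComplex R).map f) i) x
      have e2 := ConcreteCategory.congr_hom
        (((torComplex R).obj N).toCycles_i (i + 1) i) w
      exact e1.trans (hw.symm.trans e2.symm)
    have e3 := ConcreteCategory.congr_hom (((torComplex R).obj N).toCycles_comp_homologyπ (i + 1) i) w
    exact (congrArg (((torComplex R).obj N).homologyπ i) this).trans e3
  have : (torSpace R i).map f = (ModuleCat.restrictScalars (algebraMap ℂ R)).map
    (HomologicalComplex.homologyMap ((torComplex R).map f) i) := rfl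
  rw [this, h0, Functor.map_zero]
  rfl

/-- `Tor_0(M, R/𝔪)` is `M ⊗ R/𝔪`. -/
def torSpaceZeroIso (M : ModuleCat.{0} R) :
    (torSpace R 0).obj M ≅ (ModuleCat.restrictScalars (algebraMap ℂ R)).obj
      (ModuleCat.of R (M ⊗[R] IsLocalRing.ResidueField R)) :=
  (ModuleCat.restrictScalars (algebraMap ℂ R)).mapIso
    (((residueResolution R).isoLeftDerivedObj
      ((MonoidalCategory.tensoringLeft (ModuleCat.{0} R)).obj M) 0).symm ≪≫
      (Functor.leftDerivedZeroIsoSelf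
        ((MonoidalCategory.tensoringLeft (ModuleCat.{0} R)).obj M)).app _)

/-- `Tor_0(M, R/𝔪)` is `R/𝔪 ⊗ M`. -/
def torSpaceZeroEquiv (M : ModuleCat.{0} R) :
    (torSpace R 0).obj M ≃ₗ[ℂ] IsLocalRing.ResidueField R ⊗[R] M :=
  (torSpaceZeroIso M ≪≫ (ModuleCat.restrictScalars (algebraMap ℂ R)).mapIso
    (TensorProduct.comm R M (IsLocalRing.ResidueField R)).toModuleIso).toLinearEquiv ≪≫ₗ
  { toFun := fun x => x
    map_add' := fun _ _ => rfl
    map_smul' := fun c x => algebraMap_smul R c (M := IsLocalRing.ResidueField R ⊗[R] M) x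
    invFun := fun x => x
    left_inv := fun _ => rfl
    right_inv := fun _ => rfl }

theorem torRank_eq_zero {M N : ModuleCat.{0} R} (f : M ⟶ N) (i : ℕ)
    (h : (torSpace R i).map f = 0) : torRank f i = 0 := by
  rw [torRank, h, ModuleCat.hom_zero, LinearMap.range_zero, finrank_bot]

variable [Module.Finite ℂ (IsLocalRing.ResidueField R)]

theorem finite_torSpace_zero (M : ModuleCat.{0} R) [Module.Finite R M] :
    Module.Finite ℂ ((torSpace R 0).obj M) := by
  have h2 : Module.Finite ℂ (IsLocalRing.ResidueField R ⊗[R] M) :=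
    Module.Finite.trans (IsLocalRing.ResidueField R) _
  exact Module.Finite.equiv (torSpaceZeroEquiv M).symm

/-- Dimension shifting: for a free cover the connecting map embeds Tor_{i+1}(M) into Tor_i of the
kernel, which is again finitely generated. Finiteness matters because `finrank` is 0 on
infinite-dimensional spaces. -/
theorem finite_torSpace [IsNoetherianRing R] (i : ℕ) (M : ModuleCat.{0} R) [Module.Finite R M] :
    Module.Finite ℂ ((torSpace R i).obj M) := by
  induction i generalizing M with
  | zero => exact finite_torSpace_zero M
  | succ i ih =>
    obtain ⟨n, f, hf⟩ := Module.Finite.exists_fin' R M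
    have hS := LinearMap.shortExact_shortComplexKer hf
    obtain ⟨δ, h1, h2⟩ := exists_torSpace_connecting _ hS i
    have h3 : Module.Finite ℂ ((torSpace R i).obj (ModuleCat.of R (LinearMap.ker f))) := ih _
    have h4 := torSpace_succ_subsingleton (ModuleCat.of R (Fin n → R)) i
    refine Module.Finite.of_injective δ ?_
    rw [← LinearMap.ker_eq_bot, h1.linearMap_ker_eq]
    refine LinearMap.range_eq_bot.mpr ?_
    ext x
    rw [show x = 0 from h4.elim _ _]
    simp

theorem bettiNumber_eq_torRank_add [IsNoetherianRing R]
    (S : ShortComplex (ModuleCat.{0} R)) (hS : S.ShortExact) [Module.Finite R S.X₂] (i : ℕ) :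
    bettiNumber S.X₂ i = torRank S.f i + torRank S.g i := by
  have := finite_torSpace i S.X₂
  rw [bettiNumber_eq, ← LinearMap.finrank_range_add_finrank_ker ((torSpace R i).map S.g).hom,
    (torSpace_exact S hS i).linearMap_ker_eq, add_comm]
  rfl

theorem bettiNumber_zero_add [IsNoetherianRing R]
    (S : ShortComplex (ModuleCat.{0} R)) (hS : S.ShortExact)
    [Module.Finite R S.X₂] [Module.Finite R S.X₃] :
    bettiNumber S.X₃ 0 + torRank S.f 0 = bettiNumber S.X₂ 0 := by
  have := finite_torSpace 0 S.X₃
  rw [bettiNumber_eq_torRank_add S hS, add_comm, bettiNumber_eq, torRank, torRank,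
    LinearMap.range_eq_top.mpr (torSpace_surjective S hS), finrank_top]

section ShortExact

variable [IsNoetherianRing R] (S : ShortComplex (ModuleCat.{0} R)) (hS : S.ShortExact)
  [Module.Finite R S.X₁] [Module.Finite R S.X₂] [Module.Finite R S.X₃]

include hS

/-- The dimension count in the stretch of the long exact sequence from Tor_{i+1}(X₁) to Tor_i(X₂).
The two ranks are the error terms of cutting it there; they vanish for minimal covers. -/
theorem bettiNumber_succ_add (i : ℕ) :
    bettiNumber S.X₃ (i + 1) + torRank S.f (i + 1) + torRank S.f i =
      bettiNumber S.X₂ (i + 1) + bettiNumber S.X₁ i := by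
  have := finite_torSpace (i + 1) S.X₃
  have := finite_torSpace i S.X₁
  obtain ⟨δ, h1, h2⟩ := exists_torSpace_connecting S hS i
  have e1 := LinearMap.finrank_range_add_finrank_ker δ
  have e2 := LinearMap.finrank_range_add_finrank_ker ((torSpace R i).map S.f).hom
  have e3 := bettiNumber_eq_torRank_add S hS (i + 1)
  rw [h1.linearMap_ker_eq, ← bettiNumber_eq] at e1
  rw [h2.linearMap_ker_eq, ← bettiNumber_eq] at e2
  simp only [torRank] at *
  omega

end ShortExact

end ResidueResolution

/-! ### Vanishing of Tor maps over a ring retract -/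

section Retract
open TensorProduct

variable {B R : Type} [CommRing B] [CommRing R] [Algebra B R]

-- The cover must be R-flat and carry a compatible B-structure, so that B-linear maps can be lifted
-- to it. Its size is irrelevant.
variable (B) in
theorem exists_flat_cover (N : Type) [AddCommGroup N] [Module R N] :
    ∃ (G : Type) (_ : AddCommGroup G) (_ : Module R G) (_ : Module B G) (_ : IsScalarTower B R G)
      (_ : Module.Flat R G) (π : G →ₗ[R] N), Function.Surjective π :=
  ⟨N →₀ R, inferInstance, inferInstance, inferInstance, inferInstance, inferInstance,
    Finsupp.linearCombination R id, Finsupp.linearCombination_id_surjective R N⟩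

/-- A chain map from a complex of projective `B`-modules to `N ⊗ P`, where `P` is the resolution of
the residue field of the `B`-algebra `R`, sends cycles in `𝔪 E` to boundaries. -/
theorem exists_lTensor_resD_eq [IsLocalRing R] (𝔪 : Ideal B)
    (h𝔪 : 𝔪.map (algebraMap B R) ≤ IsLocalRing.maximalIdeal R) (i : ℕ) :
    ∀ (N : Type) [AddCommGroup N] [Module R N] [Module B N] [IsScalarTower B R N]
      (E : ℕ → Type) [∀ n, AddCommGroup (E n)] [∀ n, Module B (E n)]
      [∀ n, Module.Projective B (E n)] (d : ∀ n, E (n + 1) →ₗ[B] E n)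
      (_ : ∀ n x, d n (d (n + 1) x) = 0) (f : ∀ n, E n →ₗ[B] N ⊗[R] ResMod R n)
      (_ : ∀ n x, f n (d n x) = (resD R n).lTensor N (f (n + 1) x))
      (z : E i) (_ : z ∈ 𝔪 • (⊤ : Submodule B (E i)))
      (_ : ∀ j, ∀ hj : j + 1 = i, d j (hj ▸ z) = 0),
      ∃ w, (resD R i).lTensor N w = f i z := by
  induction i with
  | zero =>
    -- In degree 0 the boundaries are the kernel of N ⊗ P₀ → N ⊗ R/𝔪_R, and the ideal 𝔪 of B acts by
    -- zero on the target.
    intro N _ _ _ _ E _ _ _ d hd f hf z hz _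
    have key : ∀ y : N ⊗[R] ResMod R 0, ∀ b ∈ 𝔪, (resAug R).lTensor N (b • y) = 0 := by
      intro y b hb
      have : b • y = algebraMap B R b • y := (algebraMap_smul R b y).symm
      rw [this, map_smul]
      induction (resAug R).lTensor N y using TensorProduct.induction_on with
      | zero => simp
      | tmul n x =>
        obtain ⟨r, rfl⟩ := IsLocalRing.residue_surjective x
        rw [← TensorProduct.tmul_smul]
        have : algebraMap B R b • IsLocalRing.residue R r =
          IsLocalRing.residue R (algebraMap B R b * r) := rfl
        rw [this, (IsLocalRing.residue_eq_zero_iff _).mpr, TensorProduct.tmul_zero]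
        exact Ideal.mul_mem_right _ _ (h𝔪 (Ideal.mem_map_of_mem _ hb))
      | add a b ha hb => rw [smul_add, ha, hb, add_zero]
    refine (lTensor_exact N (resAug_exact R) (resAug_surjective R) _).mp ?_
    refine Submodule.smul_induction_on hz ?_ ?_
    · intro b hb n _
      rw [map_smul]
      exact key _ _ hb
    · intro x y hx hy
      rw [map_add, map_add, hx, hy, add_zero]
  | succ i ih =>
    -- Dimension shifting on chains. For 0 → ker π → G → N → 0, lift f to B-linear maps g into G ⊗
    -- P. The defect D = dg − gd takes values in ker π ⊗ P, one degree lower.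
    intro N _ _ _ _ E _ _ _ d hd f hf z hz hz0
    obtain ⟨G, _, _, _, _, _, π, hπ⟩ := exists_flat_cover B (R := R) N
    let ι : LinearMap.ker π →ₗ[R] G := (LinearMap.ker π).subtype
    have hι : Function.Injective ι := Subtype.val_injective
    have hex : Function.Exact ι π := fun x => by simp [ι]
    have hlift : ∀ n, ∃ g : E n →ₗ[B] G ⊗[R] ResMod R n,
        ((π.rTensor (ResMod R n)).restrictScalars B).comp g = f n := fun n =>
      Module.projective_lifting_property _ _ (LinearMap.rTensor_surjective _ hπ)
    choose g hg using hlift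
    have hg' : ∀ n x, π.rTensor (ResMod R n) (g n x) = f n x := fun n x => by
      rw [← hg]; rfl
    let D : ∀ n, E (n + 1) →ₗ[B] G ⊗[R] ResMod R n := fun n =>
      (((resD R n).lTensor G).restrictScalars B).comp (g (n + 1)) - (g n).comp (d n)
    have hcomm : ∀ {M M' : Type} [AddCommGroup M] [AddCommGroup M'] [Module R M] [Module R M']
        (h : M →ₗ[R] M') (n : ℕ) (x : M ⊗[R] ResMod R (n + 1)),
        h.rTensor _ ((resD R n).lTensor M x) = (resD R n).lTensor M' (h.rTensor _ x) := by
      intro M M' _ _ _ _ h n x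
      rw [← LinearMap.comp_apply, ← LinearMap.comp_apply, LinearMap.rTensor_comp_lTensor,
        LinearMap.lTensor_comp_rTensor]
    have hdd : ∀ {M : Type} [AddCommGroup M] [Module R M] (n : ℕ) (x : M ⊗[R] ResMod R (n + 2)),
        (resD R n).lTensor M ((resD R (n + 1)).lTensor M x) = 0 := by
      intro M _ _ n x
      rw [← LinearMap.comp_apply, ← LinearMap.lTensor_comp, (resD_exact R n).linearMap_comp_eq_zero,
        LinearMap.lTensor_zero, LinearMap.zero_apply]
    have hιr : ∀ n, Function.Injective (ι.rTensor (ResMod R n)) := fun n =>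
      Module.Flat.rTensor_preserves_injective_linearMap _ hι
    have hDπ : ∀ n x, π.rTensor (ResMod R n) (D n x) = 0 := by
      intro n x
      simp only [D, LinearMap.sub_apply, LinearMap.comp_apply, LinearMap.restrictScalars_apply,
        map_sub, hg', hf]
      rw [hcomm, hg', sub_self]
    have hD : ∀ n, ∃ g1 : E (n + 1) →ₗ[B] (LinearMap.ker π) ⊗[R] ResMod R n,
        ∀ x, ι.rTensor (ResMod R n) (g1 x) = D n x := by
      intro n
      let e := LinearEquiv.ofInjective ((ι.rTensor (ResMod R n)).restrictScalars B) (hιr n)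
      have hm : ∀ x, D n x ∈ LinearMap.range ((ι.rTensor (ResMod R n)).restrictScalars B) :=
        fun x => (rTensor_exact (ResMod R n) hex hπ _).mp (hDπ n x)
      refine ⟨e.symm.toLinearMap.comp ((D n).codRestrict _ hm), fun x => ?_⟩
      have : e (e.symm ((D n).codRestrict _ hm x)) = (D n).codRestrict _ hm x :=
        e.apply_symm_apply _
      exact congrArg Subtype.val this
    choose g1 hg1 using hD
    have hzd : d i z = 0 := hz0 i rfl
    -- With the sign on d the defect is a chain map on the shifted complex, in which z has degree i.
    obtain ⟨w1, hw1⟩ := ih (LinearMap.ker π) (fun n => E (n + 1)) (fun n => -d (n + 1))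
      (fun n x => by simp [hd]) g1 (fun n x => by
        apply hιr
        rw [hcomm, hg1, hg1]
        simp [D, hd, hdd]) z hz (by
        rintro j rfl
        simpa using hzd)
    -- Corrected by w1, the lift g(z) becomes a cycle of G ⊗ P, hence a boundary by flatness of G.
    -- The correction dies in N ⊗ P.
    have e1 : (resD R i).lTensor G (g (i + 1) z - ι.rTensor _ w1) = 0 := by
      rw [map_sub, ← hcomm, hw1, hg1]
      simp [D, hzd]
    obtain ⟨w2, hw2⟩ := (Module.Flat.lTensor_exact G (resD_exact R i) _).mp e1
    refine ⟨π.rTensor _ w2, ?_⟩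
    rw [← hcomm, hw2, map_sub, hg', ← LinearMap.comp_apply, ← LinearMap.rTensor_comp,
      hex.linearMap_comp_eq_zero, LinearMap.rTensor_zero, LinearMap.zero_apply, sub_zero]

/-- If `φ : R → B` has a section, maps of `B`-modules with values in `𝔪 Q`, `Q` projective, induce
zero on `Tor^R(·, R/𝔪)`. -/
theorem torSpace_map_restrictScalars_eq_zero {B R : Type} [CommRing B] [IsLocalRing B]
    [CommRing R] [IsLocalRing R] [Algebra ℂ R] (φ : R →+* B) (s : B →+* R)
    (hs : ∀ b, φ (s b) = b) {N Q : ModuleCat.{0} B} [Module.Projective B Q] (f : N ⟶ Q)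
    (hf : ∀ x, f.hom x ∈ IsLocalRing.maximalIdeal B • (⊤ : Submodule B Q)) (i : ℕ) :
    (torSpace R i).map ((ModuleCat.restrictScalars φ).map f) = 0 := by
  refine torSpace_map_eq_zero _ _ fun z hz => ?_
  let f' := ((ModuleCat.restrictScalars φ).map f).hom
  let Q' : Type := (ModuleCat.restrictScalars φ).obj Q
  let _ : Algebra B R := s.toAlgebra
  let _ : Algebra R B := φ.toAlgebra
  let _ : Module B Q' := inferInstanceAs (Module B Q)
  have : Module.Projective B Q' := inferInstanceAs (Module.Projective B Q)
  have : IsScalarTower R B Q' := ⟨fun r b x => by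
    change (φ r * b) • x = (_ : Q)
    rw [mul_smul]; rfl⟩
  have : IsScalarTower B R Q' := ⟨fun b r x => by
    change φ (s b * r) • (x : Q) = b • φ r • (x : Q)
    rw [map_mul, hs, mul_smul]⟩
  have hφs : IsLocalHom s := ⟨fun b hb => by
    have := hb.map φ
    rwa [hs] at this⟩
  have hp : ∀ n, Module.Projective B (Q' ⊗[R] ResMod R n) := fun n => inferInstance
  -- Take E = Q ⊗ P with the identity as chain map. The section makes the B-action on Q ⊗ P
  -- compatible with the R-action, and being local it sends 𝔪_B into 𝔪_R.
  refine exists_lTensor_resD_eq (IsLocalRing.maximalIdeal B)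
    (((IsLocalRing.local_hom_TFAE s).out 0 2).mp hφs) i Q' (fun n => Q' ⊗[R] ResMod R n)
    (fun n => ((resD R n).lTensor Q').restrictScalars B) ?_ (fun n => LinearMap.id) (fun n x => rfl)
    (f'.rTensor _ z) ?_ ?_
  · intro n x
    have : (resD R n).lTensor Q' ((resD R (n + 1)).lTensor Q' x) = 0 := by
      rw [← LinearMap.comp_apply, ← LinearMap.lTensor_comp, (resD_exact R n).linearMap_comp_eq_zero,
        LinearMap.lTensor_zero, LinearMap.zero_apply]
    exact this
  · clear hz
    induction z using TensorProduct.induction_on with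
    | zero => rw [map_zero]; exact zero_mem _
    | add a b ha hb => rw [map_add]; exact add_mem ha hb
    | tmul x p =>
      have h1 : (f' x : Q') ∈ IsLocalRing.maximalIdeal B • (⊤ : Submodule B Q') := hf x
      rw [LinearMap.rTensor_tmul]
      refine Submodule.smul_induction_on h1 ?_ ?_
      · intro b hb q _
        rw [← TensorProduct.smul_tmul']
        exact Submodule.smul_mem_smul hb trivial
      · intro x y hx hy
        rw [TensorProduct.add_tmul]
        exact add_mem hx hy
  · rintro j rfl
    have h1 := hz j rfl
    have h2 : (resD R j).lTensor Q' (f'.rTensor _ z) = f'.rTensor _ ((resD R j).lTensor _ z) := by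
      rw [← LinearMap.comp_apply, ← LinearMap.comp_apply, LinearMap.rTensor_comp_lTensor,
        LinearMap.lTensor_comp_rTensor]
    refine h2.trans ?_
    rw [show (resD R j).lTensor _ z = 0 from h1, map_zero]

end Retract

/-! ### Minimal free covers -/

section MinimalCover

/-- Finitely generated modules over a Noetherian local ring have minimal free covers. -/
theorem exists_minimal_cover {S : Type} [CommRing S] [IsLocalRing S] (M : Type) [AddCommGroup M]
    [Module S M] [Module.Finite S M] :
    ∃ (n : ℕ) (g : (Fin n → S) →ₗ[S] M), Function.Surjective g ∧
      ∀ x ∈ LinearMap.ker g, x ∈ IsLocalRing.maximalIdeal S • (⊤ : Submodule S (Fin n → S)) := by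
  classical
  have hex : ∃ n, ∃ g : (Fin n → S) →ₗ[S] M, Function.Surjective g := Module.Finite.exists_fin' S M
  obtain ⟨g, hg⟩ := Nat.find_spec hex
  have hmin := fun m (h : m < Nat.find hex) => Nat.find_min hex h
  -- The least number n of generators becomes a variable, so that n = k + 1 can be substituted
  -- below.
  revert g hmin
  generalize Nat.find hex = n
  intro g hg hmin
  refine ⟨n, g, hg, fun x hx => ?_⟩
  have hx' : ∀ j, x j ∈ IsLocalRing.maximalIdeal S := by
    intro j
    -- A relation with a unit coordinate expresses one generator by the others, against the
    -- minimality of n.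
    by_contra hj
    obtain ⟨u, hu⟩ : IsUnit (x j) := by simpa using hj
    obtain ⟨k, rfl⟩ : ∃ k, n = k + 1 := ⟨n - 1, by have := j.2; omega⟩
    let ins : (Fin k → S) →ₗ[S] (Fin (k + 1) → S) :=
      { toFun := fun y => j.insertNth (0 : S) y
        map_add' := fun a b => by rw [← Fin.insertNth_add]; simp
        map_smul' := fun a b => by
          ext i; refine Fin.succAboveCases j ?_ (fun i => ?_) i <;> simp }
    refine hmin k (Nat.lt_succ_self k) ⟨g.comp ins, fun m => ?_⟩
    obtain ⟨y, rfl⟩ := hg m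
    -- Subtracting this multiple of the relation x clears the coordinate j without changing the
    -- image under g.
    let y' := y - (y j * ↑u⁻¹) • x
    have hy' : y' j = 0 := by
      simp [y', ← hu, mul_assoc]
    refine ⟨fun i => y' (j.succAbove i), ?_⟩
    have : (j.insertNth (0 : S) (fun i => y' (j.succAbove i)) : Fin (k + 1) → S) = y' := by
      rw [← hy']
      exact Fin.insertNth_self_removeNth j y'
    change g (j.insertNth (0 : S) (fun i => y' (j.succAbove i))) = g y
    rw [this, map_sub, map_smul, LinearMap.mem_ker.mp hx, smul_zero, sub_zero]
  rw [pi_eq_sum_univ' x]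
  exact Submodule.sum_mem _ fun j _ => Submodule.smul_mem_smul (hx' j) trivial

end MinimalCover

theorem finite_restrictScalars {R S : Type} [CommRing R] [CommRing S] (φ : R →+* S)
    (hφ : Function.Surjective φ) (M : ModuleCat.{0} S)
    [h : Module.Finite S M] : Module.Finite R ((ModuleCat.restrictScalars φ).obj M) := by
  obtain ⟨t, ht⟩ := h.fg_top
  refine ⟨t, ?_⟩
  rw [eq_top_iff]
  intro x _
  have hx : (x : M) ∈ Submodule.span S (t : Set M) := ht ▸ trivial
  induction hx using Submodule.span_induction with
  | mem x h => exact Submodule.subset_span h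
  | zero => exact zero_mem _
  | add x y _ _ hx hy => exact add_mem (hx trivial) (hy trivial)
  | smul a x _ hx =>
    obtain ⟨r, rfl⟩ := hφ a
    exact Submodule.smul_mem _ r (hx trivial)

/-! ### Betti numbers along a ring homomorphism -/

section Betti
open TensorProduct

variable {R : Type} [CommRing R] [IsLocalRing R] [Algebra ℂ R]

instance (i : ℕ) : (torSpace R i).Additive := by
  unfold torSpace; infer_instance

theorem bettiNumber_zero (hκ : Module.finrank ℂ (IsLocalRing.ResidueField R) = 1)
    (M : ModuleCat.{0} R) : bettiNumber M 0 = Module.finrank (IsLocalRing.ResidueField R)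
      (IsLocalRing.ResidueField R ⊗[R] M) := by
  rw [bettiNumber_eq, (torSpaceZeroEquiv M).finrank_eq,
    ← Module.finrank_mul_finrank ℂ (IsLocalRing.ResidueField R), hκ, one_mul]

theorem bettiNumber_free_zero (hκ : Module.finrank ℂ (IsLocalRing.ResidueField R) = 1) (n : ℕ) :
    bettiNumber (ModuleCat.of R (Fin n → R)) 0 = n := by
  rw [bettiNumber_zero hκ, Module.finrank_baseChange, Module.finrank_fin_fun]

theorem bettiNumber_free_succ (M : ModuleCat.{0} R) [Module.Flat R M] (i : ℕ) :
    bettiNumber M (i + 1) = 0 := by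
  have := torSpace_succ_subsingleton M i
  rw [bettiNumber_eq]
  exact Module.finrank_zero_of_subsingleton

/-- The Betti numbers over `R` of a module over an `R`-algebra. -/
def bettiAlong {S : Type} [CommRing S] (φ : R →+* S) (M : ModuleCat.{0} S) (i : ℕ) : ℕ :=
  bettiNumber ((ModuleCat.restrictScalars φ).obj M) i

variable {S : Type} [CommRing S] (φ : R →+* S)

/-- Additive functors preserve finite biproducts. -/
theorem finrank_pi_obj (F : ModuleCat.{0} S ⥤ ModuleCat.{0} ℂ) [F.Additive] (M : Type)
    [AddCommGroup M] [Module S M] [Module.Finite ℂ (F.obj (ModuleCat.of S M))] (n : ℕ) :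
    Module.finrank ℂ (F.obj (ModuleCat.of S (Fin n → M))) =
      n * Module.finrank ℂ (F.obj (ModuleCat.of S M)) := by
  let e1 := F.mapIso (ModuleCat.biproductIsoPi (fun _ : Fin n => ModuleCat.of S M)).symm
  let e2 := F.mapBiproduct (fun _ : Fin n => ModuleCat.of S M)
  let e3 := ModuleCat.biproductIsoPi (fun _ : Fin n => F.obj (ModuleCat.of S M))
  have := (e1 ≪≫ e2 ≪≫ e3).toLinearEquiv.finrank_eq
  refine this.trans ?_
  exact (Module.finrank_pi_fintype ℂ).trans (by simp)

variable [IsNoetherianRing R] [Module.Finite ℂ (IsLocalRing.ResidueField R)]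

theorem bettiAlong_pi (hφ : Function.Surjective φ) (n i : ℕ) :
    bettiAlong φ (ModuleCat.of S (Fin n → S)) i = n * bettiAlong φ (ModuleCat.of S S) i := by
  have := finite_restrictScalars φ hφ (ModuleCat.of S S)
  have : Module.Finite ℂ ((ModuleCat.restrictScalars φ ⋙ torSpace R i).obj (ModuleCat.of S S)) :=
    finite_torSpace i ((ModuleCat.restrictScalars φ).obj (ModuleCat.of S S))
  simp only [bettiAlong, bettiNumber_eq]
  exact finrank_pi_obj (ModuleCat.restrictScalars φ ⋙ torSpace R i) S n

theorem bettiAlong_zero_add (hφ : Function.Surjective φ)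
    (T : ShortComplex (ModuleCat.{0} S)) (hT : T.ShortExact)
    [Module.Finite S T.X₂] [Module.Finite S T.X₃] :
    bettiAlong φ T.X₃ 0 + torRank ((ModuleCat.restrictScalars φ).map T.f) 0 =
      bettiAlong φ T.X₂ 0 := by
  have : Module.Finite R (T.map (ModuleCat.restrictScalars φ)).X₂ :=
    finite_restrictScalars φ hφ T.X₂
  have : Module.Finite R (T.map (ModuleCat.restrictScalars φ)).X₃ :=
    finite_restrictScalars φ hφ T.X₃
  exact bettiNumber_zero_add (T.map (ModuleCat.restrictScalars φ)) (hT.map_of_exact _)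

section ShortExact

variable (hφ : Function.Surjective φ) (T : ShortComplex (ModuleCat.{0} S)) (hT : T.ShortExact)
  [Module.Finite S T.X₁] [Module.Finite S T.X₂] [Module.Finite S T.X₃]

include hφ hT

theorem bettiAlong_succ_add (i : ℕ) :
    bettiAlong φ T.X₃ (i + 1) + torRank ((ModuleCat.restrictScalars φ).map T.f) (i + 1) +
      torRank ((ModuleCat.restrictScalars φ).map T.f) i =
      bettiAlong φ T.X₂ (i + 1) + bettiAlong φ T.X₁ i := by
  have : Module.Finite R (T.map (ModuleCat.restrictScalars φ)).X₁ :=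
    finite_restrictScalars φ hφ T.X₁
  have : Module.Finite R (T.map (ModuleCat.restrictScalars φ)).X₂ :=
    finite_restrictScalars φ hφ T.X₂
  have : Module.Finite R (T.map (ModuleCat.restrictScalars φ)).X₃ :=
    finite_restrictScalars φ hφ T.X₃
  exact bettiNumber_succ_add (T.map (ModuleCat.restrictScalars φ)) (hT.map_of_exact _) i

end ShortExact

end Betti

/-! ### Syzygy recursions for Poincaré series -/

section PoincareSeries

open PowerSeries

/-- The form in which P_M = n + t P_N, for a syzygy N of M, enters the inductions on coefficients.
-/
theorem coeff_natCast_add_X_mul_mul (n : ℕ) (p q : PowerSeries ℤ) :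
    coeff 0 (((n : PowerSeries ℤ) + X * p) * q) = n * coeff 0 q ∧
      ∀ i, coeff (i + 1) (((n : PowerSeries ℤ) + X * p) * q) = n * coeff (i + 1) q + coeff i (p * q) := by
  have h : (n : PowerSeries ℤ) = C (n : ℤ) := (map_natCast C n).symm
  rw [add_mul, mul_assoc, h]
  constructor
  · rw [map_add, coeff_C_mul, coeff_zero_X_mul, add_zero]
  · intro i
    rw [map_add, coeff_C_mul, coeff_succ_X_mul]

variable {R S : Type} [CommRing R] [IsLocalRing R] [Algebra ℂ R]
  [CommRing S] [IsLocalRing S] [Algebra ℂ S]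

theorem coeff_poincareSeries (M : ModuleCat.{0} R) (i : ℕ) :
    coeff i (poincareSeries M) = bettiNumber M i := coeff_mk _ _

theorem poincareSeries_congr {M N : ModuleCat.{0} R} (e : M ≅ N) :
    poincareSeries M = poincareSeries N := by
  ext i
  rw [coeff_poincareSeries, coeff_poincareSeries, bettiNumber_congr e]

theorem bettiAlong_id (M : ModuleCat.{0} S) (i : ℕ) :
    bettiAlong (RingHom.id S) M i = bettiNumber M i :=
  bettiNumber_congr (ModuleCat.restrictScalarsId.{0} S |>.app M) i

variable [IsNoetherianRing S] (hS : Module.finrank ℂ (IsLocalRing.ResidueField S) = 1)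

include hS

/-- The effect of a minimal free cover on the Poincaré series. -/
theorem poincareSeries_of_minimal (T : ShortComplex (ModuleCat.{0} S)) (hT : T.ShortExact) (n : ℕ)
    (e : T.X₂ ≅ ModuleCat.of S (Fin n → S)) [Module.Finite S T.X₃]
    (hmin : ∀ x, T.f.hom x ∈ IsLocalRing.maximalIdeal S • (⊤ : Submodule S T.X₂)) :
    poincareSeries T.X₃ = (n : PowerSeries ℤ) + X * poincareSeries T.X₁ := by
  have hfin : Module.Finite ℂ (IsLocalRing.ResidueField S) := Module.finite_of_finrank_eq_succ hS
  have h2 : Module.Finite S T.X₂ := Module.Finite.equiv e.toLinearEquiv.symm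
  have hproj : Module.Projective S T.X₂ := Module.Projective.of_equiv e.toLinearEquiv.symm
  have h1 : Module.Finite S T.X₁ :=
    Module.Finite.of_injective T.f.hom hT.moduleCat_injective_f
  -- The identity of S is its own section, so the retract criterion specializes to the usual
  -- vanishing for minimal covers.
  have hr : ∀ i, torRank ((ModuleCat.restrictScalars (RingHom.id S)).map T.f) i = 0 := fun i =>
    torRank_eq_zero _ _ (torSpace_map_restrictScalars_eq_zero (RingHom.id S) (RingHom.id S)
      (fun _ => rfl) T.f hmin i)
  ext i
  cases i with
  | zero =>
    have := bettiAlong_zero_add (RingHom.id S) Function.surjective_id T hT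
    rw [hr, bettiAlong_id, bettiAlong_id, bettiNumber_congr e, bettiNumber_free_zero hS] at this
    simp [coeff_poincareSeries, ← this]
  | succ i =>
    have := bettiAlong_succ_add (RingHom.id S) Function.surjective_id T hT i
    rw [hr, hr, bettiAlong_id, bettiAlong_id, bettiAlong_id, bettiNumber_free_succ T.X₂] at this
    rw [map_add, coeff_succ_X_mul, coeff_poincareSeries, coeff_poincareSeries]
    have h0 : coeff (i + 1) (n : PowerSeries ℤ) = 0 := by
      rw [← map_natCast (C (R := ℤ)), coeff_C]; simp
    rw [h0]
    exact_mod_cast by omega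

/-- `P_{S/I} = 1 + t P_I`. -/
theorem poincareSeries_of_ideal (T : ShortComplex (ModuleCat.{0} S)) (hT : T.ShortExact)
    (e : T.X₂ ≅ ModuleCat.of S S) [Module.Finite S T.X₃] [Nontrivial T.X₃] :
    poincareSeries T.X₃ = 1 + X * poincareSeries T.X₁ := by
  let u : S ≃ₗ[S] (Fin 1 → S) := (LinearEquiv.funUnique (Fin 1) S S).symm
  have := poincareSeries_of_minimal hS T hT 1 (e ≪≫ u.toModuleIso) (fun x => ?_)
  · simpa using this
  -- If the element were a unit, it would generate X₂ and force X₃ = 0.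
  have h1 : e.hom.hom (T.f.hom x) ∈ IsLocalRing.maximalIdeal S := by
    by_contra hn
    obtain ⟨v, hv⟩ : IsUnit (e.hom.hom (T.f.hom x)) := by simpa using hn
    obtain ⟨a, b, hab⟩ := exists_pair_ne T.X₃
    have hz : ∀ a : T.X₃, a = 0 := by
      intro a
      obtain ⟨c, rfl⟩ := hT.moduleCat_surjective_g a
      have : c = (e.hom.hom c * ↑v⁻¹) • T.f.hom x := by
        apply e.toLinearEquiv.injective
        change e.hom.hom c = e.hom.hom ((e.hom.hom c * ↑v⁻¹) • T.f.hom x)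
        rw [map_smul, ← hv, smul_eq_mul, mul_assoc, Units.inv_mul, mul_one]
      rw [this]
      have h0 : T.g.hom (T.f.hom x) = 0 := T.moduleCat_zero_apply x
      change T.g.hom _ = 0
      rw [map_smul, h0, smul_zero]
    exact hab ((hz a).trans (hz b).symm)
  have h2 : T.f.hom x = (e.hom.hom (T.f.hom x)) • e.inv.hom (1 : S) := by
    apply e.toLinearEquiv.injective
    change e.hom.hom (T.f.hom x) = e.hom.hom (e.hom.hom (T.f.hom x) • e.inv.hom (1 : S))
    rw [map_smul]
    have : e.hom.hom (e.inv.hom (1 : S)) = (1 : S) := e.toLinearEquiv.apply_symm_apply 1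
    rw [this, smul_eq_mul, mul_one]
  rw [h2]
  exact Submodule.smul_mem_smul h1 trivial

variable [IsNoetherianRing R] (hR : Module.finrank ℂ (IsLocalRing.ResidueField R) = 1)

include hR

/-- The effect of a minimal free cover over `S` on the Betti numbers over `R`. -/
theorem exists_syzygy (φ : R →+* S) (hφ : Function.Surjective φ) (M : ModuleCat.{0} S)
    [Module.Finite S M] :
    ∃ (n : ℕ) (N : ModuleCat.{0} S) (_ : Module.Finite S N) (r : ℕ → ℕ),
      poincareSeries M = (n : PowerSeries ℤ) + X * poincareSeries N ∧
      bettiAlong φ M 0 + r 0 = n * bettiAlong φ (ModuleCat.of S S) 0 ∧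
      (∀ i, bettiAlong φ M (i + 1) + r (i + 1) + r i =
        n * bettiAlong φ (ModuleCat.of S S) (i + 1) + bettiAlong φ N i) ∧
      ∀ s : S →+* R, (∀ b, φ (s b) = b) → ∀ i, r i = 0 := by
  have hfin : Module.Finite ℂ (IsLocalRing.ResidueField R) := Module.finite_of_finrank_eq_succ hR
  obtain ⟨n, g, hg, hmin⟩ := exists_minimal_cover (S := S) M
  have hT := LinearMap.shortExact_shortComplexKer hg
  have : Module.Finite S g.shortComplexKer.X₁ :=
    inferInstanceAs (Module.Finite S (LinearMap.ker g))
  have : Module.Finite S g.shortComplexKer.X₂ := inferInstanceAs (Module.Finite S (Fin n → S))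
  have : Module.Finite S g.shortComplexKer.X₃ := inferInstanceAs (Module.Finite S M)
  have hp := bettiAlong_pi φ hφ n
  -- r i is the rank of Tor_i^R(N) → Tor_i^R(Sⁿ). It is dropped for the general inequality and is
  -- zero when φ has a section.
  refine ⟨n, g.shortComplexKer.X₁, inferInstance,
    torRank ((ModuleCat.restrictScalars φ).map g.shortComplexKer.f),
    poincareSeries_of_minimal hS _ hT n (Iso.refl _) (fun x => hmin _ x.2),
    (bettiAlong_zero_add φ hφ _ hT).trans (hp 0), fun i => ?_, fun s hs i => ?_⟩
  · exact (bettiAlong_succ_add φ hφ _ hT i).trans (congrArg (· + _) (hp (i + 1)))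
  · have hp : Module.Projective S g.shortComplexKer.X₂ :=
      inferInstanceAs (Module.Projective S (Fin n → S))
    exact torRank_eq_zero _ _ (torSpace_map_restrictScalars_eq_zero φ s hs g.shortComplexKer.f
      (fun x => hmin _ x.2) i)

/-- The coefficientwise inequality `P^R_M ≤ P^S_M P^R_S`. -/
theorem coeff_poincareSeries_le (φ : R →+* S) (hφ : Function.Surjective φ) (i : ℕ)
    (M : ModuleCat.{0} S) [Module.Finite S M] :
    coeff i (poincareSeries ((ModuleCat.restrictScalars φ).obj M)) ≤
      coeff i (poincareSeries M *
        poincareSeries ((ModuleCat.restrictScalars φ).obj (ModuleCat.of S S))) := by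
  induction i generalizing M with
  | zero =>
    obtain ⟨n, N, _, r, h1, h2, -, -⟩ := exists_syzygy hS hR φ hφ M
    rw [h1, (coeff_natCast_add_X_mul_mul n _ _).1, coeff_poincareSeries, coeff_poincareSeries]
    exact_mod_cast Nat.le.intro h2
  | succ i ih =>
    obtain ⟨n, N, _, r, h1, -, h2, -⟩ := exists_syzygy hS hR φ hφ M
    have h3 := ih N
    rw [h1, (coeff_natCast_add_X_mul_mul n _ _).2, coeff_poincareSeries, coeff_poincareSeries]
    rw [coeff_poincareSeries] at h3
    have h4 := h2 i
    simp only [bettiAlong] at h4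
    zify at h4
    linarith

/-- If `φ` has a section, then `P^R_M = P^S_M P^R_S` for all finitely generated `S`-modules. -/
theorem poincareSeries_of_section (φ : R →+* S) (s : S →+* R) (hs : ∀ b, φ (s b) = b)
    (M : ModuleCat.{0} S) [Module.Finite S M] :
    poincareSeries ((ModuleCat.restrictScalars φ).obj M) = poincareSeries M *
        poincareSeries ((ModuleCat.restrictScalars φ).obj (ModuleCat.of S S)) := by
  ext i
  have hφ : Function.Surjective φ := fun b => ⟨s b, hs b⟩
  induction i generalizing M with
  | zero =>
    obtain ⟨n, N, _, r, h1, h2, -, h3⟩ := exists_syzygy hS hR φ hφ M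
    rw [h3 s hs, add_zero] at h2
    rw [h1, (coeff_natCast_add_X_mul_mul n _ _).1, coeff_poincareSeries, coeff_poincareSeries]
    exact_mod_cast h2
  | succ i ih =>
    obtain ⟨n, N, _, r, h1, -, h2, h3⟩ := exists_syzygy hS hR φ hφ M
    rw [h1, (coeff_natCast_add_X_mul_mul n _ _).2, ← ih N, coeff_poincareSeries,
      coeff_poincareSeries, coeff_poincareSeries]
    have h4 := h2 i
    rw [h3 s hs, h3 s hs] at h4
    exact_mod_cast h4

/-- If `P^R_{S/K} = P^S_{S/K} P^R_S`, then `P^R_K = P^S_K P^R_S`. -/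
theorem poincareSeries_ideal_of_quotient (φ : R →+* S) (hφ : Function.Surjective φ)
    (T : ShortComplex (ModuleCat.{0} S)) (hT : T.ShortExact) (e : T.X₂ ≅ ModuleCat.of S S)
    [Module.Finite S T.X₃] [Nontrivial T.X₃]
    (h : poincareSeries ((ModuleCat.restrictScalars φ).obj T.X₃) = poincareSeries T.X₃ *
        poincareSeries ((ModuleCat.restrictScalars φ).obj (ModuleCat.of S S))) :
    poincareSeries ((ModuleCat.restrictScalars φ).obj T.X₁) = poincareSeries T.X₁ *
        poincareSeries ((ModuleCat.restrictScalars φ).obj (ModuleCat.of S S)) := by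
  have hfin : Module.Finite ℂ (IsLocalRing.ResidueField R) := Module.finite_of_finrank_eq_succ hR
  have h2 : Module.Finite S T.X₂ := Module.Finite.equiv e.toLinearEquiv.symm
  have h1 : Module.Finite S T.X₁ :=
    Module.Finite.of_injective T.f.hom hT.moduleCat_injective_f
  ext i
  -- For ≥: the long exact sequence bounds b_{i+1}(X₃) by b_{i+1}(S) + b_i(X₁), all over R. By
  -- hypothesis and P^S_{X₃} = 1 + t P^S_{X₁}, the left side equals b_{i+1}(S) plus the i-th
  -- coefficient of P^S_{X₁} P^R_S.
  refine le_antisymm (coeff_poincareSeries_le hS hR φ hφ i T.X₁) ?_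
  have e1 := bettiAlong_succ_add φ hφ T hT i
  have e2 : bettiAlong φ T.X₂ (i + 1) = bettiAlong φ (ModuleCat.of S S) (i + 1) :=
    bettiNumber_congr ((ModuleCat.restrictScalars φ).mapIso e) _
  have e3 := congrArg (coeff (i + 1)) h
  rw [poincareSeries_of_ideal hS T hT e, ← Nat.cast_one (R := PowerSeries ℤ),
    (coeff_natCast_add_X_mul_mul 1 _ _).2, coeff_poincareSeries, coeff_poincareSeries] at e3
  rw [coeff_poincareSeries]
  rw [e2] at e1
  simp only [bettiAlong] at e1
  zify at e1
  push_cast at e3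
  linarith

end PoincareSeries

/-! ### Fibre products of local rings -/

section FibreProduct

/-- A short exact sequence of modules as a short complex. -/
def moduleShortComplex {S M₁ M₂ M₃ : Type} [CommRing S] [AddCommGroup M₁] [AddCommGroup M₂]
    [AddCommGroup M₃] [Module S M₁] [Module S M₂] [Module S M₃] (f : M₁ →ₗ[S] M₂)
    (g : M₂ →ₗ[S] M₃) (h : Function.Exact f g) : ShortComplex (ModuleCat.{0} S) :=
  ShortComplex.mk (ModuleCat.ofHom f) (ModuleCat.ofHom g) (by
    ext x; exact h.apply_apply_eq_zero x)

theorem moduleShortComplex_shortExact {S M₁ M₂ M₃ : Type} [CommRing S] [AddCommGroup M₁]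
    [AddCommGroup M₂] [AddCommGroup M₃] [Module S M₁] [Module S M₂] [Module S M₃]
    (f : M₁ →ₗ[S] M₂) (g : M₂ →ₗ[S] M₃) (h : Function.Exact f g) (hf : Function.Injective f)
    (hg : Function.Surjective g) : (moduleShortComplex f g h).ShortExact where
  exact := (ShortComplex.ShortExact.moduleCat_exact_iff_function_exact _).mpr h
  mono_f := (ModuleCat.mono_iff_injective _).mpr hf
  epi_g := (ModuleCat.epi_iff_surjective _).mpr hg

/-- Largeness concerns quotients S/I, whereas the fibre product argument uses the ideals themselves.
-/
theorem IsLarge.poincareAlong_ideal {R S : Type} [CommRing R] [IsLocalRing R] [Algebra ℂ R]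
    [IsNoetherianRing R] [CommRing S] [IsLocalRing S] [Algebra ℂ S] [IsNoetherianRing S]
    (hR : Module.finrank ℂ (IsLocalRing.ResidueField R) = 1)
    (hS : Module.finrank ℂ (IsLocalRing.ResidueField S) = 1)
    {φ : R →ₐ[ℂ] S} (h : IsLarge φ) (hφ : Function.Surjective φ) (I : Ideal S)
    (hI : IsSubspaceIdeal I) : poincareAlong φ I = poincare S I * poincareAlong φ S := by
  have hex : Function.Exact I.subtype I.mkQ := fun x => by
    simp [Ideal.Quotient.eq_zero_iff_mem]
  have hT := moduleShortComplex_shortExact I.subtype I.mkQ hex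
    Subtype.val_injective (Submodule.mkQ_surjective I)
  have : Module.Finite S (moduleShortComplex I.subtype I.mkQ hex).X₃ :=
    inferInstanceAs (Module.Finite S (S ⧸ I))
  have : Nontrivial (moduleShortComplex I.subtype I.mkQ hex).X₃ :=
    Ideal.Quotient.nontrivial_iff.mpr hI.2
  let e : (moduleShortComplex I.subtype I.mkQ hex).X₂ ≅ ModuleCat.of S S :=
    Iso.refl (ModuleCat.of S S)
  have key := poincareSeries_ideal_of_quotient hS hR φ.toRingHom hφ
    (moduleShortComplex I.subtype I.mkQ hex) hT e
  exact key (h I hI)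

/-- `P^S_C = 1 + t P^S_{ker a}` for a surjective homomorphism `a : S → C`. -/
theorem poincareAlong_eq_one_add {S C : Type} [CommRing S] [IsLocalRing S] [Algebra ℂ S]
    [IsNoetherianRing S] [CommRing C] [IsLocalRing C] [Algebra ℂ C]
    (hS : Module.finrank ℂ (IsLocalRing.ResidueField S) = 1) (a : S →ₐ[ℂ] C)
    (ha : Function.Surjective a) :
    poincareAlong a C = 1 + PowerSeries.X * poincare S (RingHom.ker a) := by
  let C' : Type := (ModuleCat.restrictScalars a.toRingHom).obj (ModuleCat.of C C)
  let g : S →ₗ[S] C' := 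
    { toFun := a, map_add' := map_add a, map_smul' := map_mul a }
  have hex : Function.Exact (RingHom.ker a).subtype g := fun x => by
    change a x = 0 ↔ _
    simp [RingHom.mem_ker]
  have hT := moduleShortComplex_shortExact _ g hex Subtype.val_injective ha
  have : Module.Finite S (moduleShortComplex _ g hex).X₃ := Module.Finite.of_surjective g ha
  have : Nontrivial (moduleShortComplex _ g hex).X₃ := inferInstanceAs (Nontrivial C)
  let e : (moduleShortComplex (RingHom.ker a).subtype g hex).X₂ ≅ ModuleCat.of S S :=
    Iso.refl (ModuleCat.of S S)
  have key := poincareSeries_of_ideal hS (moduleShortComplex (RingHom.ker a).subtype g hex) hT e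
  exact key

variable {R A B C : Type} [CommRing R] [Algebra ℂ R] [CommRing A] [Algebra ℂ A] [CommRing B]
  [Algebra ℂ B] [CommRing C] [Algebra ℂ C]

/-- The ring `R` is the fibre product of `a : A → C` and `b : B → C`. -/
structure IsFibreProduct (π₁ : R →ₐ[ℂ] A) (π₂ : R →ₐ[ℂ] B) (a : A →ₐ[ℂ] C) (b : B →ₐ[ℂ] C) :
    Prop where
  comm : ∀ r, a (π₁ r) = b (π₂ r)
  eq_zero : ∀ r, π₁ r = 0 → π₂ r = 0 → r = 0
  lift : ∀ x y, a x = b y → ∃ r, π₁ r = x ∧ π₂ r = y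

namespace IsFibreProduct

variable {π₁ : R →ₐ[ℂ] A} {π₂ : R →ₐ[ℂ] B} {a : A →ₐ[ℂ] C} {b : B →ₐ[ℂ] C}
  (h : IsFibreProduct π₁ π₂ a b)

include h

theorem symm : IsFibreProduct π₂ π₁ b a where
  comm r := (h.comm r).symm
  eq_zero r h1 h2 := h.eq_zero r h2 h1
  lift x y hxy := (h.lift y x hxy.symm).imp fun _ hr => hr.symm

theorem surjective_fst (hb : Function.Surjective b) : Function.Surjective π₁ := fun x => by
  obtain ⟨y, hy⟩ := hb (a x)
  exact (h.lift x y hy.symm).imp fun _ hr => hr.1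

theorem surjective_snd (ha : Function.Surjective a) : Function.Surjective π₂ :=
  h.symm.surjective_fst ha

/-- The kernel of `R → B` is isomorphic to the kernel of `A → C`. -/
theorem nonempty_kerEquiv : Nonempty (RingHom.ker π₂ ≃ₗ[R]
    (ModuleCat.restrictScalars π₁.toRingHom).obj (ModuleCat.of A (RingHom.ker a))) := by
  let f : RingHom.ker π₂ →ₗ[R]
      (ModuleCat.restrictScalars π₁.toRingHom).obj (ModuleCat.of A (RingHom.ker a)) :=
    { toFun := fun r => (⟨π₁ r.1, by
        rw [RingHom.mem_ker, h.comm, RingHom.mem_ker.mp r.2, map_zero]⟩ : RingHom.ker a)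
      map_add' := fun x y => Subtype.ext (map_add π₁ x.1 y.1)
      map_smul' := fun x y => Subtype.ext (map_mul π₁ x y.1) }
  refine ⟨LinearEquiv.ofBijective f ⟨?_, ?_⟩⟩
  · rw [injective_iff_map_eq_zero]
    intro r hr
    exact Subtype.ext (h.eq_zero _ (congrArg (Subtype.val : RingHom.ker a → A) hr) r.2)
  · intro k
    obtain ⟨r, h1, h2⟩ := h.lift (k : RingHom.ker a).1 0 (by
      rw [map_zero]; exact (k : RingHom.ker a).2)
    exact ⟨⟨r, h2⟩, Subtype.ext h1⟩

/-- The crossing of the two sides: the kernel of the projection to B is a module over A, so its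
series can be factored through R → A. -/
theorem poincare_ker [IsLocalRing R] :
    poincare R (RingHom.ker π₂) = poincareAlong π₁ (RingHom.ker a) :=
  let ⟨e⟩ := h.nonempty_kerEquiv
  poincareSeries_congr e.toModuleIso

/-- R embeds into A × B as an R-module, and both factors are Noetherian over R because the
projections are surjective. -/
theorem isNoetherianRing [IsNoetherianRing A] [IsNoetherianRing B] (ha : Function.Surjective a)
    (hb : Function.Surjective b) : IsNoetherianRing R := by
  let _ : Module R A := Module.compHom A π₁.toRingHom
  let _ : Module R B := Module.compHom B π₂.toRingHom
  have : RingHomSurjective π₁.toRingHom := ⟨h.surjective_fst hb⟩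
  have : RingHomSurjective π₂.toRingHom := ⟨h.surjective_snd ha⟩
  let l₁ : A →ₛₗ[π₁.toRingHom] A :=
    { toFun := fun x => x, map_add' := fun _ _ => rfl, map_smul' := fun _ _ => rfl }
  let l₂ : B →ₛₗ[π₂.toRingHom] B :=
    { toFun := fun x => x, map_add' := fun _ _ => rfl, map_smul' := fun _ _ => rfl }
  have h₁ : IsNoetherian R A :=
    (l₁.isNoetherian_iff_of_bijective Function.bijective_id).mpr inferInstance
  have h₂ : IsNoetherian R B :=
    (l₂.isNoetherian_iff_of_bijective Function.bijective_id).mpr inferInstance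
  let f : R →ₗ[R] A × B :=
    { toFun := fun r => (π₁ r, π₂ r)
      map_add' := fun _ _ => Prod.ext (map_add _ _ _) (map_add _ _ _)
      map_smul' := fun _ _ => Prod.ext (map_mul _ _ _) (map_mul _ _ _) }
  refine isNoetherian_of_injective f ((injective_iff_map_eq_zero _).mpr fun r hr => ?_)
  exact h.eq_zero r (congrArg Prod.fst hr) (congrArg Prod.snd hr)

theorem poincareAlong_snd_mul [IsLocalRing R] [IsLocalRing A] [IsLocalRing B] [IsLocalRing C]
    [IsNoetherianRing A] [IsNoetherianRing B]
    (hR : Module.finrank ℂ (IsLocalRing.ResidueField R) = 1)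
    (hA : Module.finrank ℂ (IsLocalRing.ResidueField A) = 1)
    (hB : Module.finrank ℂ (IsLocalRing.ResidueField B) = 1)
    (ha : Function.Surjective a) (hb : Function.Surjective b)
    (h₁ : poincareAlong π₁ (RingHom.ker a) = poincare A (RingHom.ker a) * poincareAlong π₁ A)
    (h₂ : poincareAlong π₂ (RingHom.ker b) = poincare B (RingHom.ker b) * poincareAlong π₂ B) :
    poincareAlong π₂ B * (poincareAlong a C + poincareAlong b C -
      poincareAlong a C * poincareAlong b C) = poincareAlong a C := by
  have := h.isNoetherianRing ha hb
  have e1 := poincareAlong_eq_one_add hR π₂ (h.surjective_snd ha)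
  have e2 := poincareAlong_eq_one_add hR π₁ (h.surjective_fst hb)
  have e3 := poincareAlong_eq_one_add hA a ha
  have e4 := poincareAlong_eq_one_add hB b hb
  rw [h.poincare_ker, h₁] at e1
  rw [h.symm.poincare_ker, h₂] at e2
  rw [e3, e4]
  -- With x = P^R_B, y = P^R_A, p = t P^A_K, q = t P^B_J the relations are x = 1 + p y and y = 1 + q
  -- x. The claim is x (1 − p q) = 1 + p.
  linear_combination e1 + PowerSeries.X * poincare A (RingHom.ker a) * e2

/-- A homomorphism `φ : B → A` over `C` yields a section of `R → B`. -/
theorem exists_section (φ : B →ₐ[ℂ] A) (hφ : a.comp φ = b) :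
    ∃ s : B →+* R, ∀ y, π₂ (s y) = y := by
  have hl : ∀ y, ∃ r, π₁ r = φ y ∧ π₂ r = y := fun y => h.lift _ _ (DFunLike.congr_fun hφ y)
  choose s h1 h2 using hl
  have hext : ∀ r r', π₁ r = π₁ r' → π₂ r = π₂ r' → r = r' := fun r r' e1 e2 =>
    sub_eq_zero.mp (h.eq_zero _ (by rw [map_sub, e1, sub_self]) (by rw [map_sub, e2, sub_self]))
  exact ⟨{ toFun := s
           map_one' := hext _ _ (by simp [h1]) (by simp [h2])
           map_mul' := fun x y => hext _ _ (by simp [h1]) (by simp [h2])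
           map_zero' := hext _ _ (by simp [h1]) (by simp [h2])
           map_add' := fun x y => hext _ _ (by simp [h1]) (by simp [h2]) }, h2⟩

end IsFibreProduct

/-- The expression equals 1 − t² p q, with constant term 1. -/
theorem isUnit_add_sub_mul (p q : PowerSeries ℤ) :
    IsUnit (1 + PowerSeries.X * p + (1 + PowerSeries.X * q) -
      (1 + PowerSeries.X * p) * (1 + PowerSeries.X * q)) := by
  rw [PowerSeries.isUnit_iff_constantCoeff]
  simp

end FibreProduct

/-! ### The local ring of the gluing -/

namespace FunSpace

theorem value_ne_zero_of_isUnit {S : FunSpace} {p : S} {r : S.localRing p} (h : IsUnit r) :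
    Germ.value r.1 ≠ 0 := by
  have h1 : IsUnit (Germ.valueRingHom ((S.stalk p).val r)) :=
    (h.map (S.stalk p).val).map Germ.valueRingHom
  exact h1.ne_zero

/-- The residue field of a point is `ℂ`. -/
theorem finrank_residueField (S : FunSpace) (p : S) :
    Module.finrank ℂ (IsLocalRing.ResidueField (S.localRing p)) = 1 := by
  have hs : Function.Surjective (algebraMap ℂ (IsLocalRing.ResidueField (S.localRing p))) := by
    intro k
    obtain ⟨r, rfl⟩ := IsLocalRing.residue_surjective k
    -- A germ minus its value vanishes at the point, so it is not a unit.
    refine ⟨Germ.value r.1, ?_⟩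
    have h1 : algebraMap ℂ (IsLocalRing.ResidueField (S.localRing p)) (Germ.value r.1) =
      IsLocalRing.residue _ (algebraMap ℂ (S.localRing p) (Germ.value r.1)) := rfl
    rw [h1, ← sub_eq_zero, ← map_sub, IsLocalRing.residue_eq_zero_iff, IsLocalRing.mem_maximalIdeal,
      mem_nonunits_iff]
    intro hu
    refine value_ne_zero_of_isUnit hu ?_
    have : Germ.valueRingHom ((algebraMap ℂ (Germ (𝓝 p) ℂ) (Germ.value r.1)) - r.1) =
      Germ.value r.1 - Germ.value r.1 := by rw [map_sub]; rfl
    exact this.trans (sub_self _)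
  let e : ℂ ≃ₗ[ℂ] IsLocalRing.ResidueField (S.localRing p) :=
    LinearEquiv.ofBijective (Algebra.linearMap _ _) ⟨(algebraMap ℂ _).injective, hs⟩
  rw [← e.finrank_eq, Module.finrank_self]

/-- Makes the kernels of the surjections onto the local ring of Z radical, so that largeness applies
to them. -/
instance (S : FunSpace) (p : S) : IsReduced (S.localRing p) where
  eq_zero := by
    rintro ⟨g, hg⟩ ⟨n, hn⟩
    induction g using Germ.inductionOn with
    | _ f =>
      have h1 : ((f ^ n : S → ℂ) : Germ (𝓝 p) ℂ) = ((0 : S → ℂ) : Germ (𝓝 p) ℂ) :=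
        congrArg Subtype.val hn
      refine Subtype.ext (Germ.coe_eq.mpr ?_)
      filter_upwards [Germ.coe_eq.mp h1] with q hq
      exact eq_zero_of_pow_eq_zero hq

namespace GluedSpace

variable {X Y Z : FunSpace} (α : Hom Z X) (β : Hom Z Y)

/-- The subset of `X ⊔_Z Y` given by subsets of `X` and `Y` with the same inverse image in `Z`. -/
def union (U : Set X) (W : Set Y) (h : α.toFun ⁻¹' U = β.toFun ⁻¹' W) : Set (GluedSpace α β) :=
  {q | Quot.lift (Sum.elim (· ∈ U) (· ∈ W)) (by
    rintro _ _ ⟨z, rfl, rfl⟩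
    exact propext (Set.ext_iff.mp h z)) q}

theorem isOpen_union {U : Set X} {W : Set Y} (h : α.toFun ⁻¹' U = β.toFun ⁻¹' W) (hU : IsOpen U)
    (hW : IsOpen W) : IsOpen (union α β U W h) := by
  rw [← isQuotientMap_quot_mk.isOpen_preimage, isOpen_sum_iff]
  exact ⟨hU, hW⟩

variable {α β}

/-- Since α and β are embeddings, one open neighbourhood of z can be cut out both by an open set of
X and by one of Y. Such pairs descend to open sets of the gluing, which is how germs at the glued
point are controlled. -/
theorem exists_saturated (hα : IsEmbedding α.toFun) (hβ : IsEmbedding β.toFun) (z : Z) {U : Set X}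
    {W : Set Y} {N : Set Z} (hU : U ∈ 𝓝 (α z)) (hW : W ∈ 𝓝 (β z)) (hN : N ∈ 𝓝 z) :
    ∃ (U' : Set X) (W' : Set Y), IsOpen U' ∧ IsOpen W' ∧ U' ⊆ U ∧ W' ⊆ W ∧ α z ∈ U' ∧
      β z ∈ W' ∧ α.toFun ⁻¹' U' = β.toFun ⁻¹' W' ∧ α.toFun ⁻¹' U' ⊆ N := by
  obtain ⟨U₀, hU₀, hU₀o, hzU⟩ := mem_nhds_iff.mp hU
  obtain ⟨W₀, hW₀, hW₀o, hzW⟩ := mem_nhds_iff.mp hW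
  obtain ⟨N₀, hN₀, hN₀o, hzN⟩ := mem_nhds_iff.mp hN
  have ho : IsOpen (N₀ ∩ α.toFun ⁻¹' U₀ ∩ β.toFun ⁻¹' W₀) :=
    (hN₀o.inter (hU₀o.preimage α.continuous)).inter (hW₀o.preimage β.continuous)
  obtain ⟨U₁, hU₁, h1⟩ := hα.isOpen_iff.mp ho
  obtain ⟨W₁, hW₁, h2⟩ := hβ.isOpen_iff.mp ho
  have hz : z ∈ N₀ ∩ α.toFun ⁻¹' U₀ ∩ β.toFun ⁻¹' W₀ := ⟨⟨hzN, hzU⟩, hzW⟩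
  have e1 : α.toFun ⁻¹' (U₀ ∩ U₁) = N₀ ∩ α.toFun ⁻¹' U₀ ∩ β.toFun ⁻¹' W₀ := by
    rw [Set.preimage_inter, h1]
    ext; simp only [Set.mem_inter_iff]; tauto
  have e2 : β.toFun ⁻¹' (W₀ ∩ W₁) = N₀ ∩ α.toFun ⁻¹' U₀ ∩ β.toFun ⁻¹' W₀ := by
    rw [Set.preimage_inter, h2]
    ext; simp only [Set.mem_inter_iff]; tauto
  refine ⟨U₀ ∩ U₁, W₀ ∩ W₁, hU₀o.inter hU₁, hW₀o.inter hW₁, fun x hx => hU₀ hx.1,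
    fun x hx => hW₀ hx.1, ?_, ?_, e1.trans e2.symm, ?_⟩
  · exact e1.ge hz
  · exact e2.ge hz
  · rw [e1]
    exact fun x hx => hN₀ hx.1.1

end GluedSpace

/-- The local ring of the gluing is the fibre product of the local rings. -/
theorem isFibreProduct_gluing {X Y Z : FunSpace} (α : Hom Z X) (β : Hom Z Y)
    (hα : IsEmbedding α.toFun) (hβ : IsEmbedding β.toFun) (z : Z) :
    IsFibreProduct (gluingFst α β z) (gluingSnd α β z) (α.pullbackAt z) (β.pullbackAt z) where
  comm := by
    rintro ⟨g, hg⟩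
    induction g using Germ.inductionOn with
    | _ h =>
      apply Subtype.ext
      change ((fun q => h (GluedSpace.inl α β (α q)) : Z → ℂ) : Germ (𝓝 z) ℂ) =
        ((fun q => h (GluedSpace.inr α β (β q)) : Z → ℂ) : Germ (𝓝 z) ℂ)
      congr 1
      ext q
      rw [GluedSpace.inr_eq_inl]
  eq_zero := by
    rintro ⟨g, hg⟩ h1 h2
    induction g using Germ.inductionOn with
    | _ h =>
      have h1' : ((fun q => h (GluedSpace.inl α β q) : X → ℂ) : Germ (𝓝 (α z)) ℂ) =
        ((fun _ => 0 : X → ℂ) : Germ (𝓝 (α z)) ℂ) := congrArg Subtype.val h1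
      have h2' : ((fun q => h (GluedSpace.inr α β q) : Y → ℂ) : Germ (𝓝 (β z)) ℂ) =
        ((fun _ => 0 : Y → ℂ) : Germ (𝓝 (β z)) ℂ) := congrArg Subtype.val h2
      obtain ⟨U, W, hU, hW, hUs, hWs, hzU, -, he, -⟩ := GluedSpace.exists_saturated hα hβ z
        (Germ.coe_eq.mp h1') (Germ.coe_eq.mp h2') univ_mem
      apply Subtype.ext
      refine Germ.coe_eq.mpr ?_
      filter_upwards [(GluedSpace.isOpen_union α β he hU hW).mem_nhds
        (show gluingPoint α β z ∈ GluedSpace.union α β U W he from hzU)] with q hq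
      induction q using Quot.inductionOn with
      | _ q =>
        rcases q with q | q
        · exact hUs hq
        · exact hWs hq
  lift := by
    classical
    rintro ⟨g₁, hg₁⟩ ⟨g₂, hg₂⟩ hg
    induction g₁ using Germ.inductionOn with
    | _ F =>
    induction g₂ using Germ.inductionOn with
    | _ G =>
      have hg' : ((fun q => F (α q) : Z → ℂ) : Germ (𝓝 z) ℂ) =
        ((fun q => G (β q) : Z → ℂ) : Germ (𝓝 z) ℂ) := congrArg Subtype.val hg
      -- Shrink until F and G are regular on U and W and agree on the common trace in Z. Extension
      -- by zero is then well defined on the gluing, since `α q ∈ U ↔ β q ∈ W`.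
      obtain ⟨U, W, hU, hW, hUs, hWs, hzU, hzW, he, hN⟩ := GluedSpace.exists_saturated hα hβ z
        (X.eventually_mem _ _ hg₁) (Y.eventually_mem _ _ hg₂) (Germ.coe_eq.mp hg')
      let h : GluedSpace α β → ℂ := Quot.lift
        (Sum.elim (fun x => if x ∈ U then F x else 0) (fun y => if y ∈ W then G y else 0)) (by
          rintro _ _ ⟨q, rfl, rfl⟩
          have hq : α q ∈ U ↔ β q ∈ W := Set.ext_iff.mp he q
          by_cases hU : α q ∈ U
          · have hW := hq.mp hU
            simpa [hU, hW] using hN hU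
          · have hW : β q ∉ W := fun h => hU (hq.mpr h)
            simp [hU, hW])
      have hl : ∀ x ∈ U, ((h ∘ GluedSpace.inl α β : X → ℂ) : Germ (𝓝 x) ℂ) = (F : Germ (𝓝 x) ℂ) := by
        intro x hx
        refine Germ.coe_eq.mpr ?_
        filter_upwards [hU.mem_nhds hx] with q hq
        exact if_pos hq
      have hr : ∀ y ∈ W, ((h ∘ GluedSpace.inr α β : Y → ℂ) : Germ (𝓝 y) ℂ) = (G : Germ (𝓝 y) ℂ) := by
        intro x hx
        refine Germ.coe_eq.mpr ?_
        filter_upwards [hW.mem_nhds hx] with q hq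
        exact if_pos hq
      have hreg : ∀ᶠ q in 𝓝 (gluingPoint α β z), GluedSpace.RegularAt α β h q := by
        filter_upwards [(GluedSpace.isOpen_union α β he hU hW).mem_nhds
          (show gluingPoint α β z ∈ GluedSpace.union α β U W he from hzU)] with q hq
        refine ⟨fun x hx => ?_, fun y hy => ?_⟩
        · subst hx
          rw [hl x hq]
          exact hUs hq
        · subst hy
          rw [hr y hq]
          exact hWs hq
      exact ⟨⟨_, ⟨h, rfl, hreg⟩⟩, Subtype.ext (hl _ hzU),
        Subtype.ext (hr _ hzW)⟩

end FunSpace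

-- The theorem for arbitrary function spaces with Noetherian local rings at the points of X and Y;
-- analyticity enters only through that condition.
open FunSpace in
theorem poincareAlong_gluing {X Y Z : FunSpace} (α : Hom Z X) (β : Hom Z Y)
    (hα : IsEmbedding α.toFun) (hβ : IsEmbedding β.toFun) (z : Z)
    [IsNoetherianRing (X.localRing (α z))] [IsNoetherianRing (Y.localRing (β z))]
    (hα' : Function.Surjective (α.pullbackAt z)) (hβ' : Function.Surjective (β.pullbackAt z))
    (h : (WeaklyLarge α β z ∧ ∃ φ : Y.localRing (β z) →ₐ[ℂ] X.localRing (α z),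
              Function.Surjective φ ∧ (α.pullbackAt z).comp φ = β.pullbackAt z) ∨
          StronglyLarge α β z)
    (I : Ideal (Y.localRing (β z))) (hI : IsSubspaceIdeal I) :
    IsUnit (α.poincareAt z + β.poincareAt z - α.poincareAt z * β.poincareAt z) ∧
    poincareAlong (gluingSnd α β z) (Y.localRing (β z) ⧸ I) *
        (α.poincareAt z + β.poincareAt z - α.poincareAt z * β.poincareAt z) =
      poincare (Y.localRing (β z)) (Y.localRing (β z) ⧸ I) * α.poincareAt z := by
  have hf := isFibreProduct_gluing α β hα hβ z
  have hN := hf.isNoetherianRing hα' hβ'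
  have hV := (gluing α β).finrank_residueField (gluingPoint α β z)
  have hX := X.finrank_residueField (α z)
  have hY := Y.finrank_residueField (β z)
  have hK : IsSubspaceIdeal (RingHom.ker (α.pullbackAt z)) :=
    ⟨(RingHom.ker_isRadical_iff_reduced_of_surjective hα').mpr inferInstance, RingHom.ker_ne_top _⟩
  have hJ : IsSubspaceIdeal (RingHom.ker (β.pullbackAt z)) :=
    ⟨(RingHom.ker_isRadical_iff_reduced_of_surjective hβ').mpr inferInstance, RingHom.ker_ne_top _⟩
  constructor
  · rw [Hom.poincareAt, Hom.poincareAt, poincareAlong_eq_one_add hX _ hα',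
      poincareAlong_eq_one_add hY _ hβ']
    exact isUnit_add_sub_mul _ _
  -- Both alternatives are reduced to the same three factorizations: for K, for J and for the local
  -- ring of W.
  have key : WeaklyLarge α β z ∧
      poincareAlong (gluingSnd α β z) (RingHom.ker (β.pullbackAt z)) =
        poincare (Y.localRing (β z)) (RingHom.ker (β.pullbackAt z)) *
          poincareAlong (gluingSnd α β z) (Y.localRing (β z)) ∧
      poincareAlong (gluingSnd α β z) (Y.localRing (β z) ⧸ I) =
        poincare (Y.localRing (β z)) (Y.localRing (β z) ⧸ I) *
          poincareAlong (gluingSnd α β z) (Y.localRing (β z)) := by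
    rcases h with ⟨hw, φ, -, hφ⟩ | ⟨h1, h2⟩
    · obtain ⟨s, hs⟩ := hf.exists_section φ hφ
      refine ⟨hw, ?_, ?_⟩
      · exact poincareSeries_of_section hY hV (gluingSnd α β z).toRingHom s hs
          (ModuleCat.of _ (RingHom.ker (β.pullbackAt z)))
      · exact poincareSeries_of_section hY hV (gluingSnd α β z).toRingHom s hs
          (ModuleCat.of _ (Y.localRing (β z) ⧸ I))
    · exact ⟨h1.poincareAlong_ideal hV hX (hf.surjective_fst hβ') _ hK,
        h2.poincareAlong_ideal hV hY (hf.surjective_snd hα') _ hJ, h2 I hI⟩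
  obtain ⟨h1, h2, h3⟩ := key
  have := hf.poincareAlong_snd_mul hV hX hY hα' hβ' h1 h2
  rw [h3, mul_assoc]
  exact congrArg _ this

/-! ### Division by powers of the coordinate in the disk algebra -/

section DiskAlgebra

open Metric

/-- The disk algebra: continuous functions on a closed disk that are holomorphic inside. -/
def diskSubalgebra (ρ : ℝ) : Subalgebra ℂ C(closedBall (0 : ℂ) ρ, ℂ) where
  carrier := {h | ∃ H : ℂ → ℂ, DifferentiableOn ℂ H (ball 0 ρ) ∧ ∀ w, h w = H w}
  mul_mem' := by
    rintro _ _ ⟨F, hF, h1⟩ ⟨G, hG, h2⟩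
    exact ⟨F * G, hF.mul hG, fun w => by simp [h1, h2]⟩
  add_mem' := by
    rintro _ _ ⟨F, hF, h1⟩ ⟨G, hG, h2⟩
    exact ⟨F + G, hF.add hG, fun w => by simp [h1, h2]⟩
  algebraMap_mem' := fun c => ⟨fun _ => c, differentiableOn_const c, fun _ => rfl⟩

/-- Uniform limits of holomorphic functions are holomorphic. The resulting completeness permits the
open mapping theorem later. -/
theorem isClosed_diskSubalgebra (ρ : ℝ) :
    IsClosed (diskSubalgebra ρ : Set C(closedBall (0 : ℂ) ρ, ℂ)) := by
  classical
  rw [← isSeqClosed_iff_isClosed]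
  intro u h hu hlim
  choose H hH he using hu
  let G : ℂ → ℂ := fun w => if hw : w ∈ closedBall (0 : ℂ) ρ then h ⟨w, hw⟩ else 0
  have hGw : ∀ w : closedBall (0 : ℂ) ρ, G w = h w := fun w => dif_pos w.2
  refine ⟨G, ?_, fun w => (hGw w).symm⟩
  have hconv : TendstoUniformlyOn H G atTop (ball 0 ρ) := by
    rw [ContinuousMap.tendsto_iff_tendstoUniformly] at hlim
    rw [Metric.tendstoUniformlyOn_iff]
    intro ε hε
    filter_upwards [Metric.tendstoUniformly_iff.mp hlim ε hε] with n hn w hw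
    have hw' := ball_subset_closedBall hw
    have := hn ⟨w, hw'⟩
    rw [he] at this
    rwa [← hGw] at this
  exact hconv.tendstoLocallyUniformlyOn.differentiableOn (.of_forall hH) isOpen_ball

/-- The disk algebra as a Banach algebra. -/
def DiskAlgebra (ρ : ℝ) : Type := diskSubalgebra ρ

instance (ρ : ℝ) : NormedCommRing (DiskAlgebra ρ) :=
  inferInstanceAs (NormedCommRing (diskSubalgebra ρ))

instance (ρ : ℝ) : NormedAlgebra ℂ (DiskAlgebra ρ) :=
  inferInstanceAs (NormedAlgebra ℂ (diskSubalgebra ρ))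

instance (ρ : ℝ) : CompleteSpace (DiskAlgebra ρ) :=
  (isClosed_diskSubalgebra ρ).completeSpace_coe

namespace DiskAlgebra

variable {ρ : ℝ}

/-- The element of the disk algebra given by a function that is holomorphic near the disk. -/
def ofAnalytic (H : ℂ → ℂ) (hH : AnalyticOnNhd ℂ H (closedBall 0 ρ)) : DiskAlgebra ρ :=
  ⟨⟨fun w => H w, hH.continuousOn.domRestrict⟩, H,
    hH.differentiableOn.mono ball_subset_closedBall, fun _ => rfl⟩

variable (ρ) in
/-- The coordinate function. -/
def coord : DiskAlgebra ρ := ofAnalytic id analyticOnNhd_id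

theorem norm_coord_le (hρ : 0 ≤ ρ) : ‖coord ρ‖ ≤ ρ := by
  change ‖(coord ρ).1‖ ≤ ρ
  rw [ContinuousMap.norm_le _ hρ]
  intro w
  exact mem_closedBall_zero_iff.mp w.2

theorem ext' {f g : DiskAlgebra ρ} (h : ∀ w, f.1 w = g.1 w) : f = g :=
  Subtype.ext (ContinuousMap.ext h)

/-- Evaluation at a point of the disk. -/
def eval (w : closedBall (0 : ℂ) ρ) : DiskAlgebra ρ →L[ℂ] ℂ :=
  LinearMap.mkContinuous ⟨⟨fun f => f.1 w, fun _ _ => rfl⟩, fun _ _ => rfl⟩ 1 fun f => by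
    rw [one_mul]
    exact f.1.norm_coe_le_norm w

theorem eval_apply (w : closedBall (0 : ℂ) ρ) (f : DiskAlgebra ρ) : eval w f = f.1 w := rfl

/-- Division with remainder by the coordinate function. -/
theorem exists_eq_coord_mul_add (hρ : 0 < ρ) (h : DiskAlgebra ρ) :
    ∃ (q : DiskAlgebra ρ) (c : ℂ), h = coord ρ * q + algebraMap ℂ _ c := by
  obtain ⟨h, H, hH, he⟩ := h
  -- The quotient is (H(w) − H(0))/w, with the singularity at 0 removed; away from 0 it inherits
  -- continuity up to the boundary.
  have hd : DifferentiableOn ℂ (dslope H 0) (ball 0 ρ) :=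
    (Complex.differentiableOn_dslope (ball_mem_nhds 0 hρ)).mpr hH
  have hcont : Continuous fun w : closedBall (0 : ℂ) ρ => dslope H 0 w := by
    rw [continuous_iff_continuousAt]
    intro w
    by_cases hw : (w : ℂ) = 0
    · have : DifferentiableAt ℂ (dslope H 0) (w : ℂ) :=
        hd.differentiableAt (by rw [hw]; exact ball_mem_nhds 0 hρ)
      exact ContinuousAt.comp (g := dslope H 0) this.continuousAt continuousAt_subtype_val
    · have h1 : ContinuousAt (fun v : closedBall (0 : ℂ) ρ => (v : ℂ)⁻¹ * (h v - H 0)) w :=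
        (continuousAt_subtype_val.inv₀ hw).mul (h.continuous.continuousAt.sub continuousAt_const)
      refine h1.congr ?_
      filter_upwards [continuousAt_subtype_val.eventually_ne hw] with v hv
      rw [dslope_of_ne _ hv, slope_def_field, he]
      simp [div_eq_inv_mul]
  refine ⟨⟨⟨_, hcont⟩, dslope H 0, hd, fun _ => rfl⟩, H 0, ext' fun w => ?_⟩
  change h w = w * dslope H 0 w + H 0
  have := sub_smul_dslope H 0 (w : ℂ)
  rw [sub_zero, smul_eq_mul] at this
  rw [this, he]
  ring

/-- Evaluation at 0 gives c = 0; then q vanishes off 0, and at 0 by continuity. -/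
theorem coord_mul_add_eq_zero (hρ : 0 < ρ) {q : DiskAlgebra ρ} {c : ℂ}
    (h : coord ρ * q + algebraMap ℂ _ c = 0) : q = 0 ∧ c = 0 := by
  have hw : ∀ w : closedBall (0 : ℂ) ρ, w * q.1 w + c = 0 := fun w => by
    have := congrArg (eval w) h
    rwa [map_zero] at this
  have hc : c = 0 := by simpa using hw ⟨0, by simp [hρ.le]⟩
  refine ⟨ext' fun w => ?_, hc⟩
  have hne : ∀ w : closedBall (0 : ℂ) ρ, (w : ℂ) ≠ 0 → q.1 w = 0 := fun w hw0 => by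
    have := hw w
    rw [hc, add_zero] at this
    exact (mul_eq_zero.mp this).resolve_left hw0
  by_cases hw0 : (w : ℂ) = 0
  · obtain ⟨H, hH, he⟩ := q.2
    have h0 : (0 : ℂ) ∈ ball (0 : ℂ) ρ := mem_ball_self hρ
    have hcH : ContinuousAt H 0 := (hH.differentiableAt (ball_mem_nhds 0 hρ)).continuousAt
    have hev : ∀ᶠ v in 𝓝[≠] (0 : ℂ), H v = 0 := by
      filter_upwards [nhdsWithin_le_nhds (ball_mem_nhds 0 hρ), self_mem_nhdsWithin] with v hv hv0
      rw [← he ⟨v, ball_subset_closedBall hv⟩]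
      exact hne _ hv0
    have hlim : Tendsto H (𝓝[≠] 0) (𝓝 (H 0)) := hcH.mono_left nhdsWithin_le_nhds
    have h2 : H 0 = 0 :=
      tendsto_nhds_unique hlim (tendsto_const_nhds.congr' (hev.mono fun _ h => h.symm))
    rw [he, hw0, h2]
    rfl
  · exact hne w hw0

/-- The map `(q, r) ↦ a q + ∑ r_j w^j`. -/
def divisionMap (ρ : ℝ) (k : ℕ) (a : DiskAlgebra ρ) :
    DiskAlgebra ρ × (Fin k → ℂ) →L[ℂ] DiskAlgebra ρ :=
  (ContinuousLinearMap.mul ℂ (DiskAlgebra ρ) a).comp (ContinuousLinearMap.fst ℂ _ _) +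
    (∑ j : Fin k, (ContinuousLinearMap.proj (R := ℂ) (φ := fun _ : Fin k => ℂ) j).smulRight
      (coord ρ ^ (j : ℕ))).comp (ContinuousLinearMap.snd ℂ _ _)

theorem divisionMap_apply (k : ℕ) (a q : DiskAlgebra ρ) (r : Fin k → ℂ) :
    divisionMap ρ k a (q, r) = a * q + ∑ j, r j • coord ρ ^ (j : ℕ) := by
  simp [divisionMap]

theorem divisionMap_succ (k : ℕ) (q : DiskAlgebra ρ) (r : Fin (k + 1) → ℂ) :
    divisionMap ρ (k + 1) (coord ρ ^ (k + 1)) (q, r) =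
      coord ρ * divisionMap ρ k (coord ρ ^ k) (q, fun j => r j.succ) + algebraMap ℂ _ (r 0) := by
  rw [divisionMap_apply, divisionMap_apply, Fin.sum_univ_succ, mul_add, Finset.mul_sum,
    Algebra.algebraMap_eq_smul_one]
  simp only [Fin.val_zero, pow_zero, Fin.val_succ, pow_succ', mul_smul_comm]
  ring

/-- Division by w^{k+1} is division by w followed by division of the quotient by w^k. -/
theorem divisionMap_pow_bijective (hρ : 0 < ρ) (k : ℕ) :
    Function.Bijective (divisionMap ρ k (coord ρ ^ k)) := by
  induction k with
  | zero =>
    constructor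
    · rintro ⟨q, r⟩ ⟨q', r'⟩ h
      simp only [divisionMap_apply] at h
      exact Prod.ext (by simpa using h) (Subsingleton.elim _ _)
    · intro h
      exact ⟨(h, 0), by simp [divisionMap_apply]⟩
  | succ k ih =>
    constructor
    · rw [injective_iff_map_eq_zero]
      rintro ⟨q, r⟩ h
      rw [divisionMap_succ] at h
      obtain ⟨h1, h2⟩ := coord_mul_add_eq_zero hρ h
      have h3 := (injective_iff_map_eq_zero _).mp ih.1 _ h1
      refine Prod.ext (Prod.ext_iff.mp h3).1 (funext fun j => ?_)
      refine Fin.cases h2 (fun j => ?_) j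
      exact congrFun (Prod.ext_iff.mp h3).2 j
    · intro h
      obtain ⟨q, c, rfl⟩ := exists_eq_coord_mul_add hρ h
      obtain ⟨⟨q, r⟩, rfl⟩ := ih.2 q
      refine ⟨(q, Fin.cons c r), ?_⟩
      rw [divisionMap_succ]
      simp

theorem divisionMap_bijective (hρ : 0 < ρ) (k : ℕ) {u : DiskAlgebra ρ} (hu : IsUnit u) :
    Function.Bijective (divisionMap ρ k (coord ρ ^ k * u)) := by
  obtain ⟨u, rfl⟩ := hu
  have h : ⇑(divisionMap ρ k (coord ρ ^ k * u)) = divisionMap ρ k (coord ρ ^ k) ∘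
      Prod.map (fun q => u * q) id := by
    ext1 ⟨q, r⟩
    simp [divisionMap_apply, mul_assoc]
  rw [h]
  exact (divisionMap_pow_bijective hρ k).comp
    (Function.Bijective.prodMap (Units.mulLeft_bijective u) Function.bijective_id)

theorem isUnit_ofAnalytic (H : ℂ → ℂ) (hH : AnalyticOnNhd ℂ H (closedBall 0 ρ))
    (h0 : ∀ w ∈ closedBall (0 : ℂ) ρ, H w ≠ 0) : IsUnit (ofAnalytic H hH) :=
  IsUnit.of_mul_eq_one (ofAnalytic _ (hH.inv h0)) (ext' fun w => mul_inv_cancel₀ (h0 w w.2))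

end DiskAlgebra

end DiskAlgebra

/-! ### Analytic families of operators and of slices -/

section AnalyticFamilies

/-- An analytic family of bounded operators that is invertible at a point has an analytic family of
right inverses near this point. -/
theorem exists_analyticAt_rightInverse {X V W : Type} [NormedAddCommGroup X] [NormedSpace ℂ X]
    [NormedAddCommGroup V] [NormedSpace ℂ V] [CompleteSpace V] [NormedAddCommGroup W]
    [NormedSpace ℂ W] [CompleteSpace W] {T : X → V →L[ℂ] W} {x : X} (hT : AnalyticAt ℂ T x)
    (hx : Function.Bijective (T x)) :
    ∃ S : X → W →L[ℂ] V, AnalyticAt ℂ S x ∧ ∀ᶠ y in 𝓝 x, ∀ w, T y (S y w) = w := by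
  let e : V ≃L[ℂ] W := ContinuousLinearEquiv.ofBijective (T x)
    (LinearMap.ker_eq_bot.mpr hx.1) (LinearMap.range_eq_top.mpr hx.2)
  -- Composing with T(x)⁻¹ turns the family into endomorphisms of W equal to 1 at x, where inversion
  -- is analytic.
  let U : X → W →L[ℂ] W := fun y => (T y).comp e.symm.toContinuousLinearMap
  have hU : AnalyticAt ℂ U x :=
    (((ContinuousLinearMap.compL ℂ W V W).flip e.symm.toContinuousLinearMap).analyticAt _).comp hT
  have hUx : U x = 1 := by
    ext w
    exact e.apply_symm_apply w
  have hinv : AnalyticAt ℂ (fun y => Ring.inverse (U y)) x := by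
    refine AnalyticAt.comp (g := Ring.inverse) ?_ hU
    rw [hUx]
    exact analyticAt_inverse (1 : (W →L[ℂ] W)ˣ)
  refine ⟨fun y => e.symm.toContinuousLinearMap.comp (Ring.inverse (U y)),
    ((ContinuousLinearMap.compL ℂ W W V e.symm.toContinuousLinearMap).analyticAt _).comp hinv, ?_⟩
  have hun : ∀ᶠ y in 𝓝 x, IsUnit (U y) :=
    hU.continuousAt.eventually (by rw [hUx]; exact Units.isOpen.mem_nhds isUnit_one)
  filter_upwards [hun] with y hy w
  exact DFunLike.congr_fun (Ring.mul_inverse_cancel (U y) hy) w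

namespace DiskAlgebra

open Metric

variable {ρ : ℝ}

/-- Evaluation is analytic in the point, as a map to the dual of the disk algebra. -/
theorem exists_analyticAt_eval (hρ : 0 < ρ) :
    ∃ ev : ℂ → DiskAlgebra ρ →L[ℂ] ℂ, AnalyticAt ℂ ev 0 ∧
      ∀ᶠ w in 𝓝 (0 : ℂ), ∀ hw : w ∈ closedBall (0 : ℂ) ρ, ev w = eval ⟨w, hw⟩ := by
  -- The value h(w) is the remainder of h on division by `coord ρ - w`. This division is an analytic
  -- family of operators, invertible at w = 0.
  let T : ℂ → DiskAlgebra ρ × (Fin 1 → ℂ) →L[ℂ] DiskAlgebra ρ := fun w =>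
    divisionMap ρ 1 (coord ρ ^ 1) - w • ContinuousLinearMap.fst ℂ (DiskAlgebra ρ) (Fin 1 → ℂ)
  have hT : AnalyticAt ℂ T 0 :=
    analyticAt_const.sub (analyticAt_id.smul analyticAt_const)
  obtain ⟨S, hS, hTS⟩ := exists_analyticAt_rightInverse hT (by
    simpa [T] using divisionMap_pow_bijective hρ 1)
  let c : DiskAlgebra ρ × (Fin 1 → ℂ) →L[ℂ] ℂ :=
    (ContinuousLinearMap.proj (R := ℂ) (φ := fun _ : Fin 1 => ℂ) 0).comp
      (ContinuousLinearMap.snd ℂ _ _)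
  refine ⟨fun w => c.comp (S w),
    ((ContinuousLinearMap.compL ℂ (DiskAlgebra ρ) _ ℂ c).analyticAt _).comp hS, ?_⟩
  filter_upwards [hTS] with w hw hwρ
  ext h
  have h1 := congrArg (eval ⟨w, hwρ⟩) (hw h)
  rw [← h1]
  rcases hv : S w h with ⟨q, r⟩
  have h2 : T w (q, r) = coord ρ * q + r 0 • 1 - w • q := by
    simp [T, divisionMap_apply]
  change (S w h).2 0 = _
  rw [h2, hv]
  change r 0 = w * q.1 ⟨w, hwρ⟩ + r 0 * 1 - w * q.1 ⟨w, hwρ⟩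
  ring

variable {E : Type} [NormedAddCommGroup E] [NormedSpace ℂ E]

/-- Evaluation of a multilinear form on `E × ℂ` at elements of `E` and of the disk algebra. -/
def extendMultilinear (ρ : ℝ) {k : ℕ} (p : (E × ℂ) [×k]→L[ℂ] ℂ) :
    (E × DiskAlgebra ρ) [×k]→L[ℂ] DiskAlgebra ρ :=
  MultilinearMap.mkContinuous
    { toFun := fun m => ⟨⟨fun w => p fun i => ((m i).1, (m i).2.1 w), by fun_prop⟩, by
        choose H hH he using fun i => (m i).2.2
        refine ⟨fun w => p fun i => ((m i).1, H i w), ?_, fun w => ?_⟩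
        · refine (p.contDiff (n := 1)).differentiable one_ne_zero |>.comp_differentiableOn ?_
          exact differentiableOn_pi.mpr fun i => (differentiableOn_const _).prodMk (hH i)
        · simp only [ContinuousMap.coe_mk, he]⟩
      map_update_add' := fun m i x y => ext' fun w => by
        let ev : E × DiskAlgebra ρ → E × ℂ := fun e => (e.1, e.2.1 w)
        have h := Function.comp_update ev m i
        change p (ev ∘ Function.update m i (x + y)) =
          p (ev ∘ Function.update m i x) + p (ev ∘ Function.update m i y)
        rw [h, h, h, ← p.map_update_add]
        rfl
      map_update_smul' := fun m i c x => ext' fun w => by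
        let ev : E × DiskAlgebra ρ → E × ℂ := fun e => (e.1, e.2.1 w)
        have h := Function.comp_update ev m i
        change p (ev ∘ Function.update m i (c • x)) = c • p (ev ∘ Function.update m i x)
        rw [h, h, ← p.map_update_smul]
        rfl }
    ‖p‖ fun m => by
      change ‖(_ : C(closedBall (0 : ℂ) ρ, ℂ))‖ ≤ _
      rw [ContinuousMap.norm_le _ (by positivity)]
      intro w
      refine (p.le_opNorm _).trans ?_
      gcongr with i
      exact max_le_max le_rfl ((m i).2.1.norm_coe_le_norm w)

theorem norm_extendMultilinear_le {k : ℕ} (p : (E × ℂ) [×k]→L[ℂ] ℂ) :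
    ‖extendMultilinear ρ p‖ ≤ ‖p‖ :=
  MultilinearMap.mkContinuous_norm_le _ (norm_nonneg _) _

/-- An analytic function on a neighbourhood of `0` in `E × ℂ` is an analytic family, indexed by `E`,
of elements of the disk algebra. -/
theorem exists_analyticAt_slices {f : E × ℂ → ℂ} (hf : AnalyticAt ℂ f 0) :
    ∃ ρ₀ : ℝ, 0 < ρ₀ ∧ ∀ ρ, 0 < ρ → ρ ≤ ρ₀ → ∃ Φ : E → DiskAlgebra ρ,
      AnalyticAt ℂ Φ 0 ∧ ∀ᶠ z in 𝓝 (0 : E), ∀ w, (Φ z).1 w = f (z, w) := by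
  obtain ⟨p, r, hp⟩ := hf
  obtain ⟨s, hs0, hsr⟩ := ENNReal.lt_iff_exists_nnreal_btwn.mp hp.r_pos
  refine ⟨s, by exact_mod_cast hs0, fun ρ hρ hρs => ?_⟩
  -- The power series of f with disk algebra elements in the second variable. The norms do not grow,
  -- so the radius does not shrink, and `(z, coord ρ)` can be substituted to give the slice f(z, ·).
  let P : FormalMultilinearSeries ℂ (E × DiskAlgebra ρ) (DiskAlgebra ρ) :=
    fun k => extendMultilinear ρ (p k)
  have hrad : r ≤ P.radius := hp.r_le.trans
    (FormalMultilinearSeries.radius_le_of_le fun n => norm_extendMultilinear_le (p n))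
  have hP := P.hasFPowerSeriesOnBall (hp.r_pos.trans_le hrad)
  have hball : ∀ z : E, ‖z‖ < s → (z, coord ρ) ∈ eball (0 : E × DiskAlgebra ρ) P.radius := by
    intro z hz
    rw [mem_eball_zero_iff]
    refine lt_of_le_of_lt ?_ (hsr.trans_le hrad)
    rw [← ofReal_norm, ← ENNReal.ofReal_coe_nnreal]
    exact ENNReal.ofReal_le_ofReal (max_le hz.le ((norm_coord_le hρ.le).trans hρs))
  refine ⟨fun z => P.sum (z, coord ρ), ?_, ?_⟩
  · refine AnalyticAt.comp (g := P.sum) (f := fun z : E => (z, coord ρ)) ?_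
      (analyticAt_id.prod analyticAt_const)
    exact hP.analyticAt_of_mem (hball 0 (by simpa using hs0))
  · filter_upwards [Metric.ball_mem_nhds (0 : E) (show (0 : ℝ) < s by exact_mod_cast hs0)]
      with z hz w
    have hz' : ‖z‖ < s := by simpa using hz
    have h1 := (eval w).hasSum (hP.hasSum (hball z hz'))
    have h2 : (z, (w : ℂ)) ∈ eball (0 : E × ℂ) r := by
      rw [mem_eball_zero_iff]
      refine lt_of_le_of_lt ?_ hsr
      rw [← ofReal_norm, ← ENNReal.ofReal_coe_nnreal]
      exact ENNReal.ofReal_le_ofReal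
        (max_le hz'.le ((mem_closedBall_zero_iff.mp w.2).trans hρs))
    have h3 := hp.hasSum h2
    rw [zero_add] at h1 h3
    exact h1.unique h3

end DiskAlgebra

end AnalyticFamilies

/-! ### Weierstrass division -/

section Weierstrass

open Metric DiskAlgebra

variable {E : Type} [NormedAddCommGroup E] [NormedSpace ℂ E]

theorem AnalyticAt.clm_apply_clm {X V W : Type} [NormedAddCommGroup X] [NormedSpace ℂ X]
    [NormedAddCommGroup V] [NormedSpace ℂ V] [NormedAddCommGroup W] [NormedSpace ℂ W]
    {S : X → V →L[ℂ] W} {v : X → V} {x : X} (hS : AnalyticAt ℂ S x) (hv : AnalyticAt ℂ v x) :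
    AnalyticAt ℂ (fun y => S y (v y)) x :=
  AnalyticAt.comp (g := fun p : (V →L[ℂ] W) × V => p.1 p.2) (f := fun y => (S y, v y))
    ((ContinuousLinearMap.id ℂ (V →L[ℂ] W)).analyticAt_bilinear (S x, v x)) (hS.prod hv)

/-- Weierstrass division, existence. -/
theorem exists_weierstrass_division {f : E × ℂ → ℂ} (hf : AnalyticAt ℂ f 0)
    (h0 : ¬ ∀ᶠ w in 𝓝 (0 : ℂ), f (0, w) = 0) :
    ∃ k : ℕ, ∀ g : E × ℂ → ℂ, AnalyticAt ℂ g 0 →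
      ∃ (q : E × ℂ → ℂ) (r : Fin k → E → ℂ), AnalyticAt ℂ q 0 ∧ (∀ j, AnalyticAt ℂ (r j) 0) ∧
        ∀ᶠ p in 𝓝 (0 : E × ℂ), g p = q p * f p + ∑ j, r j p.1 * p.2 ^ (j : ℕ) := by
  have hf0 : AnalyticAt ℂ (fun w : ℂ => f (0, w)) 0 :=
    AnalyticAt.comp (g := f) (f := fun w : ℂ => ((0 : E), w)) hf
      (analyticAt_const.prod analyticAt_id)
  -- k is the order of f(0, ·) at 0, so it does not depend on g; only the radius ρ does.
  obtain ⟨k, u, hu, hu0, hfu⟩ := hf0.exists_eventuallyEq_pow_smul_nonzero_iff.mpr h0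
  refine ⟨k, fun g hg => ?_⟩
  obtain ⟨ρ₁, hρ₁, h1⟩ := exists_analyticAt_slices hf
  obtain ⟨ρ₂, hρ₂, h2⟩ := exists_analyticAt_slices hg
  obtain ⟨ρ₃, hρ₃, h3⟩ := nhds_basis_closedBall.eventually_iff.mp
    (hu.eventually_analyticAt.and ((hu.continuousAt.eventually_ne hu0).and hfu))
  let ρ := min ρ₁ (min ρ₂ ρ₃)
  have hρ : 0 < ρ := lt_min hρ₁ (lt_min hρ₂ hρ₃)
  obtain ⟨Φ, hΦ, hΦf⟩ := h1 ρ hρ (min_le_left _ _)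
  obtain ⟨Γ, hΓ, hΓg⟩ := h2 ρ hρ ((min_le_right _ _).trans (min_le_left _ _))
  have hρ₃' : ∀ w ∈ closedBall (0 : ℂ) ρ, w ∈ closedBall (0 : ℂ) ρ₃ := fun w hw =>
    closedBall_subset_closedBall ((min_le_right _ _).trans (min_le_right _ _)) hw
  have hua : AnalyticOnNhd ℂ u (closedBall 0 ρ) := fun w hw => (h3 (hρ₃' w hw)).1
  -- On the slice z = 0 the divisor is w^k times a unit, so the division operator is bijective there
  -- and has analytic right inverses for nearby z.
  have hΦ0 : Φ 0 = coord ρ ^ k * ofAnalytic u hua := by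
    refine ext' fun w => ?_
    rw [hΦf.self_of_nhds w, (h3 (hρ₃' w w.2)).2.2, sub_zero]
    rfl
  have hT : AnalyticAt ℂ (fun z => divisionMap ρ k (Φ z)) 0 := by
    refine AnalyticAt.add ?_ analyticAt_const
    let L := ((ContinuousLinearMap.compL ℂ (DiskAlgebra ρ × (Fin k → ℂ)) (DiskAlgebra ρ)
      (DiskAlgebra ρ)).flip (ContinuousLinearMap.fst ℂ _ _)).comp
        (ContinuousLinearMap.mul ℂ (DiskAlgebra ρ))
    exact (L.analyticAt _).comp hΦ
  obtain ⟨S, hS, hTS⟩ := exists_analyticAt_rightInverse hT (by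
    rw [hΦ0]
    exact divisionMap_bijective hρ k (isUnit_ofAnalytic u hua fun w hw => (h3 (hρ₃' w hw)).2.1))
  have hv := hS.clm_apply_clm hΓ
  obtain ⟨ev, hev, heval⟩ := exists_analyticAt_eval hρ
  have hq : AnalyticAt ℂ (fun z => (S z (Γ z)).1) 0 :=
    ((ContinuousLinearMap.fst ℂ (DiskAlgebra ρ) (Fin k → ℂ)).analyticAt _).comp hv
  -- The quotient is a disk algebra element depending on z. Its joint analyticity in (z, w) uses
  -- that evaluation at w is analytic in w.
  refine ⟨fun p => ev p.2 (S p.1 (Γ p.1)).1, fun j z => (S z (Γ z)).2 j, ?_, fun j => ?_, ?_⟩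
  · refine AnalyticAt.clm_apply_clm ?_ ?_
    · exact AnalyticAt.comp (g := ev) (f := fun p : E × ℂ => p.2) hev analyticAt_snd
    · exact AnalyticAt.comp (g := fun z => (S z (Γ z)).1) (f := fun p : E × ℂ => p.1) hq
        analyticAt_fst
  · let c : DiskAlgebra ρ × (Fin k → ℂ) →L[ℂ] ℂ :=
      (ContinuousLinearMap.proj (R := ℂ) (φ := fun _ : Fin k => ℂ) j).comp
        (ContinuousLinearMap.snd ℂ _ _)
    exact (c.analyticAt _).comp hv
  · have e1 : ∀ᶠ p in 𝓝 (0 : E × ℂ), (∀ w, (Φ p.1).1 w = f (p.1, w)) ∧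
        (∀ w, (Γ p.1).1 w = g (p.1, w)) ∧ ∀ a, divisionMap ρ k (Φ p.1) (S p.1 a) = a :=
      (continuous_fst.tendsto (0 : E × ℂ)).eventually (hΦf.and (hΓg.and hTS))
    have e2 : ∀ᶠ p in 𝓝 (0 : E × ℂ), p.2 ∈ closedBall (0 : ℂ) ρ ∧
        ∀ hw : p.2 ∈ closedBall (0 : ℂ) ρ, ev p.2 = eval ⟨p.2, hw⟩ :=
      (continuous_snd.tendsto (0 : E × ℂ)).eventually
        (Filter.Eventually.and (closedBall_mem_nhds (0 : ℂ) hρ) heval)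
    filter_upwards [e1, e2] with ⟨z, w⟩ ⟨a1, a2, a3⟩ ⟨b1, b2⟩
    have key := congrArg (eval ⟨w, b1⟩) (a3 (Γ z))
    rcases hvz : S z (Γ z) with ⟨q, r⟩
    rw [hvz, divisionMap_apply, map_add, map_sum] at key
    simp only [map_smul] at key
    change (Φ z).1 ⟨w, b1⟩ * q.1 ⟨w, b1⟩ + ∑ j, r j * w ^ (j : ℕ) = (Γ z).1 ⟨w, b1⟩ at key
    rw [a1, a2] at key
    simp only [b2 b1, eval_apply]
    rw [← key, mul_comm]

end Weierstrass

/-! ### Germs of analytic functions -/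

section Germs

variable (E : Type) [NormedAddCommGroup E] [NormedSpace ℂ E]

/-- The ring of germs of analytic functions at the origin. -/
def analyticGerms : Subalgebra ℂ (Germ (𝓝 (0 : E)) ℂ) where
  carrier := {g | ∃ F : E → ℂ, AnalyticAt ℂ F 0 ∧ g = F}
  mul_mem' := by
    rintro _ _ ⟨F, hF, rfl⟩ ⟨G, hG, rfl⟩
    exact ⟨F * G, hF.mul hG, rfl⟩
  add_mem' := by
    rintro _ _ ⟨F, hF, rfl⟩ ⟨G, hG, rfl⟩
    exact ⟨F + G, hF.add hG, rfl⟩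
  algebraMap_mem' := fun c => ⟨fun _ => c, analyticAt_const, rfl⟩

variable {E}

/-- The germ of an analytic function. -/
def analyticGerm (F : E → ℂ) (hF : AnalyticAt ℂ F 0) : analyticGerms E := ⟨F, F, hF, rfl⟩

theorem analyticGerm_surjective (x : analyticGerms E) : ∃ F hF, x = analyticGerm F hF := by
  obtain ⟨_, F, hF, rfl⟩ := x
  exact ⟨F, hF, rfl⟩

/-- Pullback of analytic germs. -/
def analyticGermsMap {E' : Type} [NormedAddCommGroup E'] [NormedSpace ℂ E'] (L : E →L[ℂ] E') :
    analyticGerms E' →+* analyticGerms E :=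
  (((germPullback L (p := 0) (q := 0) (by simpa using L.continuous.tendsto 0)).comp
    (analyticGerms E').val).codRestrict (analyticGerms E) (by
      rintro ⟨_, F, hF, rfl⟩
      refine ⟨F ∘ L, AnalyticAt.comp (by rwa [map_zero]) (L.analyticAt 0), rfl⟩)).toRingHom

end Germs

/-! ### Noetherianity of analytic local rings -/

section Noetherian

/-- A ring is Noetherian if its quotients by nonzero principal ideals are. -/
theorem isNoetherianRing_of_quotient_span_singleton {R : Type} [CommRing R]
    (h : ∀ f : R, f ≠ 0 → IsNoetherianRing (R ⧸ Ideal.span {f})) : IsNoetherianRing R := by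
  rw [isNoetherianRing_iff_ideal_fg]
  intro I
  by_cases hI : I = ⊥
  · rw [hI]; exact Submodule.fg_bot
  obtain ⟨f, hfI, hf⟩ := Submodule.exists_mem_ne_zero_of_ne_bot hI
  have hN := h f hf
  let σ := Ideal.Quotient.mk (Ideal.span {f})
  have : RingHomSurjective σ := ⟨Ideal.Quotient.mk_surjective⟩
  let l : (R ⧸ Ideal.span {f}) →ₛₗ[σ] (R ⧸ Ideal.span {f}) :=
    { toFun := fun x => x
      map_add' := fun _ _ => rfl
      map_smul' := fun r x => by
        obtain ⟨x, rfl⟩ := Ideal.Quotient.mk_surjective x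
        rfl }
  have hN' : IsNoetherian R (R ⧸ Ideal.span {f}) :=
    (l.isNoetherian_iff_of_bijective Function.bijective_id).mpr hN
  -- The image of I in the quotient is finitely generated, and I meets the kernel in (f) because f ∈
  -- I.
  refine Submodule.fg_of_fg_map_of_fg_inf_ker (Ideal.span {f}).mkQ (hN'.noetherian _) ?_
  rw [Submodule.ker_mkQ, inf_eq_right.mpr]
  · exact ⟨{f}, by simp⟩
  · rwa [Ideal.span_singleton_le_iff_mem]

/-- If every element of `S` has a remainder of bounded degree in `w` with coefficients in a
Noetherian ring upon division by `f`, then `S ⧸ (f)` is Noetherian. -/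
theorem isNoetherianRing_quotient_of_division {A S : Type} [CommRing A] [CommRing S]
    [IsNoetherianRing A] (π : A →+* S) {f : S} (w : S) (k : ℕ)
    (h : ∀ g, ∃ (q : S) (r : Fin k → A), g = q * f + ∑ j, π (r j) * w ^ (j : ℕ)) :
    IsNoetherianRing (S ⧸ Ideal.span {f}) := by
  let _ : Algebra A S := π.toAlgebra
  have hfin : Module.Finite A (S ⧸ Ideal.span {f}) := by
    rw [Module.finite_def, Submodule.fg_def]
    refine ⟨Set.range fun j : Fin k => Ideal.Quotient.mk _ (w ^ (j : ℕ)), Set.finite_range _, ?_⟩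
    rw [eq_top_iff]
    intro x _
    obtain ⟨g, rfl⟩ := Ideal.Quotient.mk_surjective x
    obtain ⟨q, r, rfl⟩ := h g
    rw [map_add, Ideal.Quotient.eq_zero_iff_mem.mpr
      (Ideal.mul_mem_left _ _ (Ideal.mem_span_singleton_self _)), zero_add, map_sum]
    refine Submodule.sum_mem _ fun j _ => ?_
    exact Submodule.smul_mem _ (r j) (Submodule.subset_span (Set.mem_range_self j))
  exact isNoetherian_of_tower A (inferInstance : IsNoetherian A (S ⧸ Ideal.span {f}))

variable {E : Type} [NormedAddCommGroup E] [NormedSpace ℂ E]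

theorem isNoetherianRing_quotient_of_regular [IsNoetherianRing (analyticGerms E)]
    {f : E × ℂ → ℂ} (hf : AnalyticAt ℂ f 0) (h0 : ¬ ∀ᶠ w in 𝓝 (0 : ℂ), f (0, w) = 0) :
    IsNoetherianRing (analyticGerms (E × ℂ) ⧸ Ideal.span {analyticGerm f hf}) := by
  obtain ⟨k, hk⟩ := exists_weierstrass_division hf h0
  let π := analyticGermsMap (ContinuousLinearMap.fst ℂ E ℂ)
  let w : analyticGerms (E × ℂ) := analyticGerm Prod.snd analyticAt_snd
  refine isNoetherianRing_quotient_of_division π w k fun x => ?_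
  obtain ⟨g, hg, rfl⟩ := analyticGerm_surjective x
  obtain ⟨q, r, hq, hr, he⟩ := hk g hg
  refine ⟨analyticGerm q hq, fun j => analyticGerm (r j) (hr j), Subtype.ext ?_⟩
  have h1 : (fun p => q p * f p + ∑ j, r j p.1 * p.2 ^ (j : ℕ)) =
      q * f + ∑ j, (r j ∘ Prod.fst) * Prod.snd ^ (j : ℕ) := by
    ext p
    simp
  rw [Subalgebra.coe_add, AddSubmonoidClass.coe_finsetSum]
  refine (Germ.coe_eq.mpr he).trans ?_
  rw [h1]
  refine (map_add (Germ.coeRingHom _) _ _).trans ?_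
  rw [map_sum]
  rfl

theorem isUnit_analyticGerm {F : E → ℂ} (hF : AnalyticAt ℂ F 0) (h0 : F 0 ≠ 0) :
    IsUnit (analyticGerm F hF) := by
  refine IsUnit.of_mul_eq_one (analyticGerm _ (hF.inv h0)) (Subtype.ext (Germ.coe_eq.mpr ?_))
  filter_upwards [hF.continuousAt.eventually_ne h0] with x hx
  exact mul_inv_cancel₀ hx

/-- An analytic function that vanishes near `0` on all lines through `0` vanishes near `0`. -/
theorem AnalyticAt.eventually_eq_zero_of_lines {F : E → ℂ} (hF : AnalyticAt ℂ F 0)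
    (h : ∀ v : E, ∀ᶠ t in 𝓝 (0 : ℂ), F (t • v) = 0) : ∀ᶠ x in 𝓝 0, F x = 0 := by
  obtain ⟨r, hr, hball⟩ := Metric.nhds_basis_ball.eventually_iff.mp hF.eventually_analyticAt
  filter_upwards [Metric.ball_mem_nhds 0 hr] with x hx
  let L : ℂ →L[ℂ] E := (ContinuousLinearMap.id ℂ ℂ).smulRight x
  have hL : ∀ t, L t = t • x := fun t => rfl
  -- Identity theorem on the line t ↦ t x: the preimage of the ball is convex and contains both t =
  -- 0 and t = 1.
  have hU : AnalyticOnNhd ℂ (F ∘ L) (L ⁻¹' Metric.ball 0 r) := fun t ht =>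
    (hball ht).comp (L.analyticAt t)
  have hc : IsPreconnected (L ⁻¹' Metric.ball 0 r) :=
    letI := NormedSpace.restrictScalars ℝ ℂ E
    ((convex_ball (0 : E) r).linear_preimage (L.toLinearMap.restrictScalars ℝ)).isPreconnected
  have := hU.eqOn_zero_of_preconnected_of_eventuallyEq_zero hc (z₀ := 0)
    (by simpa [hL] using hr) (h x)
  have h1 := this (x := 1) (by simpa [hL] using hx)
  simpa [hL] using h1

/-- Linear changes of coordinates of analytic germs. -/
def analyticGermsEquiv {E' : Type} [NormedAddCommGroup E'] [NormedSpace ℂ E'] (e : E ≃L[ℂ] E') :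
    analyticGerms E' ≃+* analyticGerms E :=
  RingEquiv.ofRingHom (analyticGermsMap e.toContinuousLinearMap)
    (analyticGermsMap e.symm.toContinuousLinearMap)
    (by
      refine RingHom.ext fun x => ?_
      obtain ⟨F, hF, rfl⟩ := analyticGerm_surjective x
      exact Subtype.ext (Germ.coe_eq.mpr (.of_forall fun x => congrArg F (e.symm_apply_apply x))))
    (by
      refine RingHom.ext fun x => ?_
      obtain ⟨F, hF, rfl⟩ := analyticGerm_surjective x
      exact Subtype.ext (Germ.coe_eq.mpr (.of_forall fun x => congrArg F (e.apply_symm_apply x))))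

/-- The ring of germs of analytic functions is Noetherian. -/
theorem isNoetherianRing_analyticGerms (n : ℕ) : ∀ (E : Type) [NormedAddCommGroup E]
    [NormedSpace ℂ E] [FiniteDimensional ℂ E], Module.finrank ℂ E = n →
      IsNoetherianRing (analyticGerms E) := by
  induction n using Nat.strong_induction_on with
  | _ n ih =>
  intro E _ _ _ hE
  refine isNoetherianRing_of_quotient_span_singleton fun f hf => ?_
  obtain ⟨F, hF, rfl⟩ := analyticGerm_surjective f
  by_cases h0 : F 0 = 0
  swap
  · have : Subsingleton (analyticGerms E ⧸ Ideal.span {analyticGerm F hF}) :=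
      Ideal.Quotient.subsingleton_iff.mpr
        (Ideal.span_singleton_eq_top.mpr (isUnit_analyticGerm hF h0))
    infer_instance
  -- A direction along which F does not vanish identically becomes the last coordinate. In E ≅ V × ℂ
  -- the germ is then regular in w, and V has smaller dimension.
  obtain ⟨v, hv⟩ : ∃ v : E, ¬ ∀ᶠ t in 𝓝 (0 : ℂ), F (t • v) = 0 := by
    by_contra! hcon
    exact hf (Subtype.ext (Germ.coe_eq.mpr (hF.eventually_eq_zero_of_lines hcon)))
  have hv0 : v ≠ 0 := by
    rintro rfl
    exact hv (.of_forall fun t => by rwa [smul_zero])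
  obtain ⟨V, hV⟩ := Submodule.exists_isCompl (Submodule.span ℂ {v})
  let e₀ : (V × ℂ) ≃ₗ[ℂ] E := (LinearEquiv.prodComm ℂ V ℂ).trans
    (((LinearEquiv.toSpanNonzeroSingleton ℂ E v hv0).prodCongr (LinearEquiv.refl ℂ V)).trans
      (Submodule.prodEquivOfIsCompl _ V hV))
  let e : (V × ℂ) ≃L[ℂ] E := e₀.toContinuousLinearEquiv
  have he : ∀ t : ℂ, e (0, t) = t • v := fun t => by simp [e, e₀]
  have hdim : Module.finrank ℂ V < n := by
    have := e₀.finrank_eq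
    rw [Module.finrank_prod, Module.finrank_self] at this
    omega
  have hN := ih _ hdim V rfl
  have hFe : AnalyticAt ℂ (F ∘ e) 0 :=
    AnalyticAt.comp (by rwa [map_zero]) (e.toContinuousLinearMap.analyticAt 0)
  have h1 := isNoetherianRing_quotient_of_regular hFe (by simpa [he] using hv)
  exact isNoetherianRing_of_ringEquiv _ (Ideal.quotientEquiv (Ideal.span {analyticGerm F hF})
    (Ideal.span {analyticGerm _ hFe}) (analyticGermsEquiv e) (by
      rw [Ideal.map_span, Set.image_singleton]
      rfl)).symm

/-- The local rings of an analytic set are Noetherian. -/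
instance {n : ℕ} (X : Set (Fin n → ℂ)) (p : analyticModel X) :
    IsNoetherianRing ((analyticModel X).localRing p) := by
  have := isNoetherianRing_analyticGerms _ (Fin n → ℂ) rfl
  let pt : Fin n → ℂ := p.1
  -- Translation moves the point to the origin; the local ring is then a quotient of the germs on
  -- ℂⁿ.
  have ht : Tendsto (fun q : analyticModel X => (q.1 : Fin n → ℂ) - pt) (𝓝 p) (𝓝 0) := by
    have : ContinuousAt (fun q : X => (q : Fin n → ℂ) - pt) p :=
      continuousAt_subtype_val.sub continuousAt_const
    have h := this.tendsto
    rwa [sub_self] at h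
  let φ : analyticGerms (Fin n → ℂ) →ₐ[ℂ] (analyticModel X).stalk p :=
    ((germPullback _ ht).comp (analyticGerms _).val).codRestrict _ (by
      rintro ⟨_, F, hF, rfl⟩
      refine ⟨fun q => F (q - pt), ?_, rfl⟩
      refine AnalyticAt.comp (g := F) (f := fun q => q - pt) ?_ (analyticAt_id.sub analyticAt_const)
      rwa [sub_self])
  refine isNoetherianRing_of_surjective _ ((analyticModel X).stalk p) φ.toRingHom ?_
  rintro ⟨_, F, hF, rfl⟩
  refine ⟨analyticGerm (fun q => F (q + pt)) ?_, ?_⟩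
  · refine AnalyticAt.comp (g := F) (f := fun q => q + pt) ?_ (analyticAt_id.add analyticAt_const)
    rwa [zero_add]
  · apply Subtype.ext
    change ((fun q : analyticModel X => F (q.1 - pt + pt) : analyticModel X → ℂ) : Germ (𝓝 p) ℂ) = _
    simp only [sub_add_cancel]
    rfl

end Noetherian

end

theorem theorem3p12 {n m l : ℕ}
    (X : Set (Fin n → ℂ)) (Y : Set (Fin m → ℂ)) (Z : Set (Fin l → ℂ))
    (hX : IsAnalyticSet X) (hY : IsAnalyticSet Y) (hZ : IsAnalyticSet Z)
    (α : FunSpace.Hom (analyticModel Z) (analyticModel X))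
    (β : FunSpace.Hom (analyticModel Z) (analyticModel Y))
    (hα : IsEmbedding α) (hβ : IsEmbedding β)
    (z : analyticModel Z)
    (hα' : Function.Surjective (α.pullbackAt z)) (hβ' : Function.Surjective (β.pullbackAt z))
    (h : (FunSpace.WeaklyLarge α β z ∧
            ∃ φ : (analyticModel Y).localRing (β z) →ₐ[ℂ] (analyticModel X).localRing (α z),
              Function.Surjective φ ∧ (α.pullbackAt z).comp φ = β.pullbackAt z) ∨
          FunSpace.StronglyLarge α β z)
    (I : Ideal ((analyticModel Y).localRing (β z))) (hI : IsSubspaceIdeal I) :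
    IsUnit (α.poincareAt z + β.poincareAt z - α.poincareAt z * β.poincareAt z) ∧
    poincareAlong (FunSpace.gluingSnd α β z) ((analyticModel Y).localRing (β z) ⧸ I) *
        (α.poincareAt z + β.poincareAt z - α.poincareAt z * β.poincareAt z) =
      poincare ((analyticModel Y).localRing (β z)) ((analyticModel Y).localRing (β z) ⧸ I) *
        α.poincareAt z :=
  poincareAlong_gluing α β hα hβ z hα' hβ' h I hI
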